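/- Write $\mathbb R_+=(0,\infty)$. Let $X$ be a locally compact Polish space and let $\mathbb M(X)$ be the set of Radon measures on $X$ (Borel measures finite on compact sets), with the Borel $\sigma$-algebra of the vague topology (the weakest topology making $\eta\mapsto\int f\,d\eta$ continuous for all $f\in C_0(X)$, the continuous compactly supported functions $X\to\mathbb R$). Let $\mathbb K(X)\subset\mathbb M(X)$ be the set of discrete Radon measures $\eta=\sum_i s_i\delta_{x_i}$ (at most countably many distinct atoms $x_i$, weights $s_i>0$), and put $s_x=\eta(\{x\})$. For $Z\subset X$ let $\mathcal B_0(Z)$ be the collection of Borel sets $A\subset Z$ with compact closure in $X$. Let $C_0(X\to\mathbb R_+)$ be the group of continuous $\theta:X\to\mathbb R_+$ equal to $1$ outside a compact set; it acts on $\mathbb M(X)$ by letting $\theta\eta$ be the measure with density $\theta$ with respect to $\eta$. Let $\sigma$ be a Radon measure on $X$ with $\sigma(\{x\})=0$ for all $x$, and let $l:X\times\mathbb R_+\to[0,\infty)$ be measurable such that for each $x\in X$ either $l(x,s)>0$ for all $s\in\mathbb R_+$ or $l(x,s)=0$ for all $s\in\mathbb R_+$. Put $Y=\{x\in X: l(x,\cdot)>0\}$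 and assume $$\int_A\int_{\mathbb R_+} l(x,s)\min\{s^{-1},1\}\,ds\,d\sigma(x)<\infty\qquad\text{for all }A\in\mathcal B_0(Y).$$ Let $dm(x,s)=\frac{l(x,s)}{s}\,d\sigma(x)\,ds$ on $X\times\mathbb R_+$. A *completely random measure with Lévy measure $m$* is a probability measure $\mu_m$ on $\mathbb M(X)$ with $\mu_m(\mathbb K(X))=1$, under which $\eta(A_1),\dots,\eta(A_n)$ are independent for all mutually disjoint $A_1,\dots,A_n\in\mathcal B_0(X)$, and such that $$\int e^{i\int f\,d\eta}\,d\mu_m(\eta)=\exp\Big[\int_{X\times\mathbb R_+}\big(e^{isf(x)}-1\big)\,dm(x,s)\Big],\qquad f\in C_0(X).$$ Assume that for some $\epsilon>0$ there are measurable functions $l_1,l_2$ with $l(x,s)=l_1(x,s)+l_2(x,s)$ for $x\in Y$, $s\in(0,\epsilon)$, such that for each $x\in Y$ the function $l_1(x,\cdot)$ is differentiable on $(0,\epsilon)$, and for all $n\in\{1,2,\dots\}$ and $A\in\mathcal B_0(Y)$ $$\int_A\int_{(0,\epsilon/n)}\ \sup_{u\in[s/n,\,sn]}\Big|\frac{\partial}{\partial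 u}l_1(x,u)\Big|\,ds\,d\sigma(x)<\infty \quad\text{and}\quad \int_A\int_{(0,\epsilon)}\frac{|l_2(x,s)|}{s}\,ds\,d\sigma(x)<\infty .$$ Then: 1. For each $n\in\{1,2,\dots\}$ there exists $\epsilon'>0$ such that for each $A\in\mathcal B_0(Y)$ $$\int_A\Big[\sup_{r\in[1/n,n]}\int_{(0,\epsilon')}\frac{|l(x,rs)-l(x,s)|}{s}\,ds\Big]d\sigma(x)<\infty .$$ 2. A completely random measure with Lévy measure $m$ exists, and every such $\mu_m$ is quasi-invariant under $C_0(X\to\mathbb R_+)$: for each $\theta\in C_0(X\to\mathbb R_+)$, $\theta$ maps $\mathbb K(X)$ into itself, and the push-forward $\mu_m^\theta$ of $\mu_m$ under $\eta\mapsto\theta\eta$ is equivalent to $\mu_m$. Moreover, for $\mu_m$-a.a. $\eta$, $$\frac{d\mu_m^\theta}{d\mu_m}(\eta)=\exp\bigg[\int_Y\log\Big(\frac{l(x,\theta^{-1}(x)s_x)}{l(x,s_x)}\Big)s_x^{-1}\,d\eta(x)+\int_Y\int_{\mathbb R_+}\frac{l(x,s)-l(x,\theta^{-1}(x)s)}{s}\,ds\,d\sigma(x)\bigg],$$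 where the integrand with respect to $\eta$ belongs to $L^1(Y,\eta)$ for $\mu_m$-a.a. $\eta$, and the integrand with respect to $ds\,d\sigma(x)$ is integrable on $Y\times\mathbb R_+$. Here $\theta^{-1}(x)=1/\theta(x)$. -/

import Mathlib

open MeasureTheory ProbabilityTheory Set

noncomputable section

namespace CRM

/-- The set `𝕄(X)` of Radon measures on `X`: Borel measures finite on compact sets. -/
def RadonMeasure (X : Type*) [TopologicalSpace X] [MeasurableSpace X] : Type _ :=
  {η : Measure X // IsFiniteMeasureOnCompacts η}

/-- The vague topology: the weakest topology making `η ↦ ∫ f dη` continuous for every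
continuous compactly supported `f : X → ℝ`. -/
instance vagueTopology (X : Type*) [TopologicalSpace X] [MeasurableSpace X] :
    TopologicalSpace (RadonMeasure X) :=
  ⨅ f : CompactlySupportedContinuousMap X ℝ,
    TopologicalSpace.induced (fun η : RadonMeasure X => ∫ x, f x ∂η.1) inferInstance

/-- The Borel `σ`-algebra of the vague topology. -/
instance vagueBorel (X : Type*) [TopologicalSpace X] [MeasurableSpace X] :
    MeasurableSpace (RadonMeasure X) :=
  borel (RadonMeasure X)

instance (X : Type*) [TopologicalSpace X] [MeasurableSpace X] : BorelSpace (RadonMeasure X) :=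
  ⟨rfl⟩

/-- The cone `𝕂(X)` of discrete Radon measures `∑ i, s i • δ_(x i)` with at most countably many
distinct atoms (possibly none) and positive weights. -/
def discreteRadon (X : Type*) [TopologicalSpace X] [MeasurableSpace X] : Set (RadonMeasure X) :=
  {η | ∃ T : Set X, T.Countable ∧ ∃ w : T → ℝ, (∀ x, 0 < w x) ∧
    η.1 = Measure.sum fun x : T => ENNReal.ofReal (w x) • Measure.dirac (x : X)}

/-- `𝓑₀(Z)` for `Z ⊆ X`: the Borel subsets of `Z` which have compact closure in `X`. -/
def boundedBorel {X : Type*} [TopologicalSpace X] [MeasurableSpace X] (Z : Set X) :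
    Set (Set X) :=
  {A | MeasurableSet A ∧ IsCompact (closure A) ∧ A ⊆ Z}

/-- The current group `C₀(X → ℝ₊)`: continuous `θ : X → (0, ∞)` equal to `1` outside a
compact set. -/
structure Current (X : Type*) [TopologicalSpace X] where
  /-- the underlying function -/
  toFun : X → ℝ
  continuous' : Continuous toFun
  pos' : ∀ x, 0 < toFun x
  eq_one' : ∃ C : Set X, IsCompact C ∧ ∀ x ∉ C, toFun x = 1

instance (X : Type*) [TopologicalSpace X] : CoeFun (Current X) (fun _ => X → ℝ) :=
  ⟨Current.toFun⟩

section Action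

variable {X : Type*} [TopologicalSpace X] [MeasurableSpace X]

theorem isFiniteMeasureOnCompacts_withDensity (θ : Current X) (η : RadonMeasure X) :
    IsFiniteMeasureOnCompacts (η.1.withDensity fun x => ENNReal.ofReal (θ x)) := by
  have := η.2
  obtain ⟨C, hC, h1⟩ := θ.eq_one'
  obtain ⟨M, hM⟩ := (hC.image θ.continuous').bddAbove
  have hle : ∀ x, θ x ≤ max M 1 := fun x => by
    by_cases hx : x ∈ C
    · exact (hM (mem_image_of_mem _ hx)).trans (le_max_left _ _)
    · exact (h1 x hx).le.trans (le_max_right _ _)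
  have hmono : η.1.withDensity (fun x => ENNReal.ofReal (θ x)) ≤
      η.1.withDensity (fun _ => ENNReal.ofReal (max M 1)) :=
    withDensity_mono (Filter.Eventually.of_forall fun x => ENNReal.ofReal_le_ofReal (hle x))
  refine ⟨fun K hK => (hmono K).trans_lt ?_⟩
  rw [withDensity_const, Measure.smul_apply, smul_eq_mul]
  exact ENNReal.mul_lt_top ENNReal.ofReal_lt_top hK.measure_lt_top

/-- The action of a current on Radon measures: `θη` has density `θ` with respect to `η`. -/
def Current.act (θ : Current X) (η : RadonMeasure X) : RadonMeasure X :=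
  ⟨η.1.withDensity fun x => ENNReal.ofReal (θ x), isFiniteMeasureOnCompacts_withDensity θ η⟩

/-- The action is vaguely continuous, so push-forwards under it are meaningful. -/
theorem Current.continuous_act [BorelSpace X] (θ : Current X) : Continuous θ.act := by
  refine continuous_iInf_rng.2 fun f => continuous_induced_rng.2 ?_
  let g : CompactlySupportedContinuousMap X ℝ :=
    ⟨⟨fun x => θ x * f x, θ.continuous'.mul f.continuous⟩, f.hasCompactSupport.mul_left⟩
  have : (fun η : RadonMeasure X => ∫ x, f x ∂η.1) ∘ θ.act = fun η => ∫ x, g x ∂η.1 := by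
    funext η
    simp only [Function.comp, Current.act]
    rw [integral_withDensity_eq_integral_toReal_smul
      (θ.continuous'.measurable.ennreal_ofReal) (Filter.Eventually.of_forall fun _ => ENNReal.ofReal_lt_top)]
    refine integral_congr_ae (Filter.Eventually.of_forall fun x => ?_)
    simp [g, ENNReal.toReal_ofReal (θ.pos' x).le]
  rw [this]
  exact continuous_iff_le_induced.2 ((iInf_le _ g))

end Action

/-- A random measure, given by its law `μ`, is completely random if its values on finitely many
mutually disjoint sets from `𝓑₀(X)` are independent. -/
def IsCompletelyRandom {X : Type*} [TopologicalSpace X] [MeasurableSpace X]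
    (μ : Measure (RadonMeasure X)) : Prop :=
  ∀ (n : ℕ) (A : Fin n → Set X), (∀ i, A i ∈ boundedBorel (univ : Set X)) →
    Pairwise (fun i j => Disjoint (A i) (A j)) →
    iIndepFun (fun (i : Fin n) (η : RadonMeasure X) => η.1 (A i)) μ

/-- `μ` is (the law of) a completely random measure, concentrated on `𝕂(X)`, with Lévy measure
`m` on `X × ℝ₊`; the latter is a measure on `X × ℝ` which does not charge `X × (-∞, 0]`. -/
structure HasLevyMeasure {X : Type*} [TopologicalSpace X] [MeasurableSpace X]
    (μ : Measure (RadonMeasure X)) (m : Measure (X × ℝ)) : Prop where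
  isProbabilityMeasure : IsProbabilityMeasure μ
  isCompletelyRandom : IsCompletelyRandom μ
  ae_mem_discreteRadon : ∀ᵐ η ∂μ, η ∈ discreteRadon X
  fourier : ∀ f : CompactlySupportedContinuousMap X ℝ,
    ∫ η : RadonMeasure X, Complex.exp (Complex.I * ((∫ x, f x ∂η.1 : ℝ) : ℂ)) ∂μ =
      Complex.exp (∫ p : X × ℝ, (Complex.exp (Complex.I * ((p.2 * f p.1 : ℝ) : ℂ)) - 1) ∂m)

/-- The measure `dm(x,s) = l(x,s) / s dσ(x) ds` on `X × (0, ∞)`. -/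
def levyMeasure {X : Type*} [MeasurableSpace X] (σ : Measure X) (l : X → ℝ → ℝ) :
    Measure (X × ℝ) :=
  (σ.prod (volume.restrict (Ioi (0 : ℝ)))).withDensity
    fun p => ENNReal.ofReal (l p.1 p.2 / p.2)

/-- The set `Y = {x ∈ X | l(x,·) > 0}`. -/
def posSet {X : Type*} (l : X → ℝ → ℝ) : Set X :=
  {x | ∀ s : ℝ, 0 < s → 0 < l x s}

/-- For each `n ∈ {1, 2, …}` there is `ε > 0` such that for all `A ∈ 𝓑₀(Y)`
`∫_A sup_{r ∈ [1/n, n]} ∫_(0,ε) |l(x,rs) - l(x,s)| / s ds dσ(x) < ∞`. -/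
def ScalingCondition {X : Type*} [TopologicalSpace X] [MeasurableSpace X] (σ : Measure X)
    (l : X → ℝ → ℝ) : Prop :=
  ∀ n : ℕ, 1 ≤ n → ∃ ε : ℝ, 0 < ε ∧ ∀ A ∈ boundedBorel (posSet l),
    ∫⁻ x in A, ⨆ r ∈ Icc (1 / (n : ℝ)) (n : ℝ),
      ∫⁻ s in Ioo (0 : ℝ) ε, ENNReal.ofReal (|l x (r * s) - l x s| / s) ∂volume ∂σ < ⊤

/-- The function `x ↦ log (l(x, θ⁻¹(x) s_x) / l(x, s_x)) s_x⁻¹`, where `s_x = η({x})`. -/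
def logRatio {X : Type*} [TopologicalSpace X] [MeasurableSpace X] (l : X → ℝ → ℝ)
    (θ : Current X) (η : RadonMeasure X) (x : X) : ℝ :=
  Real.log (l x ((θ x)⁻¹ * η.1.real {x}) / l x (η.1.real {x})) * (η.1.real {x})⁻¹

/-- The integrand `(l(x,s) - l(x, θ⁻¹(x) s)) / s`. -/
def compensator {X : Type*} [TopologicalSpace X] (l : X → ℝ → ℝ) (θ : Current X) (x : X)
    (s : ℝ) : ℝ :=
  (l x s - l x ((θ x)⁻¹ * s)) / s

/-- The proposed density of `μ ^ θ` with respect to `μ`. -/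
def currentDensity {X : Type*} [TopologicalSpace X] [MeasurableSpace X] (σ : Measure X)
    (l : X → ℝ → ℝ) (θ : Current X) (η : RadonMeasure X) : ℝ :=
  Real.exp ((∫ x in posSet l, logRatio l θ η x ∂η.1) +
    ∫ x in posSet l, ∫ s in Ioi (0 : ℝ), compensator l θ x s ∂volume ∂σ)

end CRM

end

open Filter Topology
open scoped ENNReal NNReal

noncomputable section

namespace PoissonRandom

-- Independent coordinates and the Poisson law.

section Product

variable {ι E : Type*} [MeasurableSpace E] (ν : ι → Measure E) [∀ i, IsProbabilityMeasure (ν i)]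

-- A completely random measure with Lévy measure `m` is the image of a Poisson point process on `X ×
-- ℝ₊` with intensity `m` under the map sending a point `(x, s)` to the atom `s δ_x`. The Fourier
-- transform determines the law (`ext_of_fourier`), so every `μ_m` is this image, and all statements
-- may be checked on the Poisson model.
--
-- In that model `θ` moves a point `(x, s)` to `(x, θ(x) s)`. Since `ds / s` is invariant under
-- scaling, this carries `m` to `ρ m` with `ρ(x, s) = l(x, θ⁻¹(x) s) / l(x, s)` (`map_levyMeasure`).
-- Changing the intensity of a Poisson process `N` from `m` to `ρ m` should multiply its law by `exp
-- (∫ log ρ dN - ∫ (ρ - 1) dm)`. This is verified through Fourier transforms: Campbell's formula `E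
-- exp (∫ h dN) = exp (∫ (e^h - 1) dm)` with `h = log ρ + i s f` gives the exponent `∫ ρ (e^{isf} -
-- 1) dm + ∫ (ρ - 1) dm`. The second term is cancelled by the compensator, and by the change of
-- variables the first is the exponent of the image law (`map_act_sampleRadon`). As `σ` has no
-- atoms, distinct points of `N` have distinct positions, so the weight `s` is recovered as `s_x =
-- η({x})`, and `∫ log ρ dN` becomes the integral of `logRatio` against `η`.
--
-- The analytic input is `ρ - 1 ∈ L¹(m)`. For small `s` this is the scaling condition of the first
-- claim, which follows from the mean value theorem for `l₁` and from scale invariance of `ds / s`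
-- for `l₂` (`scalingCondition`); for large `s` it follows from the integrability of `l`
-- (`lintegral_compensator_lt_top`). It also yields `min(|log ρ|, 1) ∈ L¹(m)`, so that `log ρ` is
-- almost surely summable over the points.
--
-- The Poisson process is built from countably many independent batches, each a Poisson number of
-- independent points. Campbell's formula holds for finitely many batches by direct computation and
-- passes to the limit by dominated convergence, with the integrable bound `prodBound`.

theorem lintegral_prod_infinitePi (S : Finset ι) {g : ι → E → ℝ≥0∞} (hg : ∀ i, Measurable (g i)) :
    ∫⁻ x, ∏ i ∈ S, g i (x i) ∂(Measure.infinitePi ν) = ∏ i ∈ S, ∫⁻ y, g i y ∂(ν i) := by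
  rw [lintegral_prod_eq_prod_lintegral_of_indepFun S (fun i (x : ι → E) => g i (x i))
    (iIndepFun_infinitePi hg) (fun i => (hg i).comp (measurable_pi_apply i))]
  exact Finset.prod_congr rfl fun i _ =>
    (measurePreserving_eval_infinitePi ν i).lintegral_comp (hg i)

theorem integral_prod_infinitePi (S : Finset ι) {g : ι → E → ℂ} (hg : ∀ i, Measurable (g i)) :
    ∫ x, ∏ i ∈ S, g i (x i) ∂(Measure.infinitePi ν) = ∏ i ∈ S, ∫ y, g i y ∂(ν i) := by
  have hind : iIndepFun (fun (i : S) (x : ι → E) => x i) (Measure.infinitePi ν) :=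
    iIndepFun.precomp (g := fun i : S => (i : ι)) Subtype.val_injective
      (iIndepFun_infinitePi (P := ν) (X := fun _ y => y) fun _ => measurable_id)
  have h := hind.integral_fun_prod_comp (f := fun i : S => g i)
    (fun i => (measurable_pi_apply _).aemeasurable)
    (fun i => (hg i).aestronglyMeasurable)
  have e1 : ∀ x : ι → E, ∏ i : S, g i (x i) = ∏ i ∈ S, g i (x i) := fun x =>
    Finset.prod_coe_sort S fun i => g i (x i)
  simp only [e1] at h
  rw [h, Finset.prod_coe_sort S fun i => ∫ x : ι → E, g i (x i) ∂(Measure.infinitePi ν)]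
  refine Finset.prod_congr rfl fun i _ => ?_
  have hmp := measurePreserving_eval_infinitePi ν i
  rw [← hmp.map_eq, integral_map (measurable_pi_apply i).aemeasurable
    (hg i).aestronglyMeasurable]

end Product

section PoissonLaw

theorem poissonMeasure_zero : poissonMeasure 0 = Measure.dirac 0 := by
  refine Measure.ext_of_singleton fun n => ?_
  rw [poissonMeasure_singleton]
  cases n <;> simp

theorem integral_pow_poissonMeasure (r : ℝ≥0) (c : ℂ) :
    ∫ n, c ^ n ∂(poissonMeasure r) = Complex.exp (r * (c - 1)) := by
  rw [integral_poissonMeasure]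
  have h : ∀ n : ℕ, (Real.exp (-r) * (r : ℝ) ^ n / (n.factorial : ℝ)) • c ^ n =
      (Real.exp (-r) : ℂ) * (((r : ℂ) * c) ^ n / n.factorial) := fun n => by
    rw [Complex.real_smul]; push_cast; rw [mul_pow]; ring
  simp_rw [h]
  rw [tsum_mul_left, (NormedSpace.expSeries_div_hasSum_exp ((r : ℂ) * c)).tsum_eq,
    ← Complex.exp_eq_exp_ℂ, Complex.ofReal_exp, ← Complex.exp_add]
  push_cast
  ring_nf

/-- Only the product `r * b` has to be finite: a batch with `r = 0` is empty, and then `b` may be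
infinite. -/
theorem lintegral_pow_poissonMeasure (r : ℝ≥0) (b : ℝ≥0∞) (h : (r : ℝ≥0∞) * b ≠ ⊤) :
    ∫⁻ n, (1 + b) ^ n ∂(poissonMeasure r) = ENNReal.ofReal (Real.exp ((r : ℝ≥0∞) * b).toReal) := by
  rcases eq_or_ne r 0 with rfl | hr
  · simp [poissonMeasure_zero]
  have hb : b ≠ ⊤ := by
    rintro rfl
    exact h (ENNReal.mul_top (by simpa using hr))
  lift b to ℝ≥0 using hb
  have hint : Integrable (fun n : ℕ => (1 + (b : ℝ)) ^ n) (poissonMeasure r) := by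
    rw [integrable_poissonMeasure_iff]
    have h2 := (NormedSpace.expSeries_div_summable ((r : ℝ) * (1 + b))).mul_left (Real.exp (-r))
    refine h2.congr fun n => ?_
    rw [Real.norm_of_nonneg (by positivity), mul_pow]; ring
  have h1 : ∀ n : ℕ, (1 + (b : ℝ≥0∞)) ^ n = ENNReal.ofReal ((1 + (b : ℝ)) ^ n) := fun n => by
    rw [ENNReal.ofReal_pow (by positivity),
      ENNReal.ofReal_add zero_le_one b.coe_nonneg, ENNReal.ofReal_one, ENNReal.ofReal_coe_nnreal]
  simp_rw [h1]
  rw [← ofReal_integral_eq_lintegral_ofReal hint (Eventually.of_forall fun n => by positivity)]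
  congr 1
  have h2 := integral_pow_poissonMeasure r (1 + (b : ℂ))
  have h3 : ∀ n : ℕ, (1 + (b : ℂ)) ^ n = (((1 + (b : ℝ)) ^ n : ℝ) : ℂ) := fun n => by push_cast; rfl
  simp_rw [h3] at h2
  rw [integral_complex_ofReal] at h2
  have h4 : Complex.exp (r * (1 + (b : ℂ) - 1)) = ((Real.exp (r * b) : ℝ) : ℂ) := by
    push_cast; ring_nf
  rw [h4] at h2
  rw [Complex.ofReal_injective h2]
  simp

end PoissonLaw

-- Poisson point measures and Campbell's formula.

section PointMeasure

variable {E : Type*} [MeasurableSpace E]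

/-- A sample: numbers of points in countably many batches, and the points of each batch. -/
abbrev Sample (E : Type*) : Type _ := (ℕ → ℕ) × ((_ : ℕ) × ℕ → E)

/-- The points with positions `⟨k, j⟩`, `j < n k`, `k < K`. -/
def indices (n : ℕ → ℕ) (K : ℕ) : Finset ((_ : ℕ) × ℕ) :=
  (Finset.range K).sigma fun k => Finset.range (n k)

/-- The point measure made of the first `n k` points of every batch `k`. -/
def pointMeasure (ω : Sample E) : Measure E :=
  Measure.sum fun k => ∑ j ∈ Finset.range (ω.1 k), Measure.dirac (ω.2 ⟨k, j⟩)

variable (r : ℕ → ℝ≥0) (ν : ℕ → Measure E) [∀ k, IsProbabilityMeasure (ν k)]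

/-- The law of the batches: independent Poisson numbers of independent points. -/
def sampleLaw : Measure (Sample E) :=
  (Measure.infinitePi fun k => poissonMeasure (r k)).prod
    (Measure.infinitePi fun i : (_ : ℕ) × ℕ => ν i.1)

instance : IsProbabilityMeasure (sampleLaw r ν) := by
  unfold sampleLaw; infer_instance

/-- The intensity measure of the point measure under `sampleLaw`. -/
def intensity : Measure E := Measure.sum fun k => (r k : ℝ≥0∞) • ν k

theorem lintegral_pointMeasure (ω : Sample E) {g : E → ℝ≥0∞} (hg : Measurable g) :
    ∫⁻ y, g y ∂(pointMeasure ω) = ∑' k, ∑ j ∈ Finset.range (ω.1 k), g (ω.2 ⟨k, j⟩) := by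
  rw [pointMeasure, lintegral_sum_measure]
  refine tsum_congr fun k => ?_
  rw [lintegral_finsetSum_measure]
  exact Finset.sum_congr rfl fun j _ => lintegral_dirac' _ hg

theorem measurable_sum_comp {g : E → ℝ≥0∞} (hg : Measurable g) (k : ℕ) :
    Measurable fun ω : Sample E => ∑ j ∈ Finset.range (ω.1 k), g (ω.2 ⟨k, j⟩) := by
  have h : Measurable (Function.uncurry fun (n : ℕ) (x : (_ : ℕ) × ℕ → E) =>
      ∑ j ∈ Finset.range n, g (x ⟨k, j⟩)) :=
    measurable_from_prod_countable_right fun n =>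
      Finset.measurable_sum (f := fun j (x : (_ : ℕ) × ℕ → E) => g (x ⟨k, j⟩)) (Finset.range n)
        fun j _ => hg.comp (measurable_pi_apply _)
  exact h.comp (show Measurable fun ω : Sample E => (ω.1 k, ω.2) from
    ((measurable_pi_apply k).comp measurable_fst).prodMk measurable_snd)

theorem measurable_prod_comp {M : Type*} [CommMonoid M] [MeasurableSpace M] [MeasurableMul₂ M]
    {g : E → M} (hg : Measurable g) (K : ℕ) :
    Measurable fun ω : Sample E => ∏ i ∈ indices ω.1 K, g (ω.2 i) := by
  have h1 : ∀ k, Measurable fun ω : Sample E => ∏ j ∈ Finset.range (ω.1 k), g (ω.2 ⟨k, j⟩) := by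
    intro k
    have h : Measurable (Function.uncurry fun (n : ℕ) (x : (_ : ℕ) × ℕ → E) =>
        ∏ j ∈ Finset.range n, g (x ⟨k, j⟩)) :=
      measurable_from_prod_countable_right fun n =>
        Finset.measurable_prod (f := fun j (x : (_ : ℕ) × ℕ → E) => g (x ⟨k, j⟩)) (Finset.range n)
          fun j _ => hg.comp (measurable_pi_apply _)
    exact h.comp (show Measurable fun ω : Sample E => (ω.1 k, ω.2) from
    ((measurable_pi_apply k).comp measurable_fst).prodMk measurable_snd)
  have h2 : (fun ω : Sample E => ∏ i ∈ indices ω.1 K, g (ω.2 i)) = fun ω =>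
      ∏ k ∈ Finset.range K, ∏ j ∈ Finset.range (ω.1 k), g (ω.2 ⟨k, j⟩) := by
    funext ω
    rw [indices, Finset.prod_sigma]
  rw [h2]
  exact Finset.measurable_prod _ fun k _ => h1 k

theorem measurable_pointMeasure : Measurable (pointMeasure : Sample E → Measure E) := by
  refine Measure.measurable_of_measurable_coe _ fun s hs => ?_
  have h : ∀ ω : Sample E, pointMeasure ω s =
      ∑' k, ∑ j ∈ Finset.range (ω.1 k), s.indicator 1 (ω.2 ⟨k, j⟩) := fun ω => by
    rw [← lintegral_indicator_one hs, lintegral_pointMeasure ω (measurable_one.indicator hs)]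
  simp_rw [h]
  exact Measurable.tsum fun k => measurable_sum_comp (measurable_one.indicator hs) k

/-- Given the batch sizes, independence of the points turns the mean of the product into `∏ (1 + ∫ v
dν_k) ^ n_k`, and the Poisson mean of the `k`-th factor is `exp (r_k ∫ v dν_k)`. The bound does not
depend on `K` because it uses the sum over all batches. -/
theorem lintegral_prod_one_add {v : E → ℝ≥0∞} (hv : Measurable v)
    (hfin : ∫⁻ y, v y ∂(intensity r ν) ≠ ⊤) (K : ℕ) :
    ∫⁻ ω, ∏ i ∈ indices ω.1 K, (1 + v (ω.2 i)) ∂(sampleLaw r ν) ≤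
      ENNReal.ofReal (Real.exp (∫⁻ y, v y ∂(intensity r ν)).toReal) := by
  have hm : Measurable fun y => 1 + v y := measurable_const.add hv
  rw [sampleLaw, lintegral_prod _ (measurable_prod_comp hm K).aemeasurable]
  have h1 : ∀ n : ℕ → ℕ, ∫⁻ x, ∏ i ∈ indices n K, (1 + v (x i))
      ∂(Measure.infinitePi fun i : (_ : ℕ) × ℕ => ν i.1) =
      ∏ k ∈ Finset.range K, (1 + ∫⁻ y, v y ∂(ν k)) ^ (n k) := fun n => by
    rw [lintegral_prod_infinitePi (fun i : (_ : ℕ) × ℕ => ν i.1) (indices n K)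
      (g := fun _ y => 1 + v y) fun _ => hm]
    have : ∀ k, ∫⁻ y, (1 + v y) ∂(ν k) = 1 + ∫⁻ y, v y ∂(ν k) := fun k => by
      rw [lintegral_add_left measurable_const]; simp
    simp_rw [this]
    rw [indices, Finset.prod_sigma]
    simp
  simp_rw [h1]
  rw [lintegral_prod_infinitePi (fun k => poissonMeasure (r k)) (Finset.range K)
    (g := fun k n => (1 + ∫⁻ y, v y ∂(ν k)) ^ n) fun _ => measurable_of_countable _]
  have hsum : ∫⁻ y, v y ∂(intensity r ν) = ∑' k, (r k : ℝ≥0∞) * ∫⁻ y, v y ∂(ν k) := by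
    rw [intensity, lintegral_sum_measure]
    exact tsum_congr fun k => lintegral_smul_measure _ _
  rw [hsum] at hfin ⊢
  have hfin' := ENNReal.ne_top_of_tsum_ne_top hfin
  rw [Finset.prod_congr rfl fun k _ => lintegral_pow_poissonMeasure (r k) _ (hfin' k),
    ← ENNReal.ofReal_prod_of_nonneg fun k _ => (Real.exp_pos _).le, ← Real.exp_sum,
    ← ENNReal.toReal_sum fun k _ => hfin' k]
  exact ENNReal.ofReal_le_ofReal (Real.exp_le_exp.2
    (ENNReal.toReal_mono hfin (ENNReal.sum_le_tsum _)))

/-- An upper bound for all products `∏ (1 + v)` over finitely many points. -/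
def prodBound (v : E → ℝ≥0∞) (ω : Sample E) : ℝ≥0∞ :=
  ⨆ K, ∏ i ∈ indices ω.1 K, (1 + v (ω.2 i))

theorem measurable_prodBound {v : E → ℝ≥0∞} (hv : Measurable v) : Measurable (prodBound v) :=
  Measurable.iSup fun K => measurable_prod_comp (measurable_const.add hv) K

theorem indices_mono (n : ℕ → ℕ) : Monotone (indices n) := fun _ _ h =>
  Finset.sigma_mono (Finset.range_mono h) fun _ => le_rfl

theorem lintegral_prodBound_lt_top {v : E → ℝ≥0∞} (hv : Measurable v)
    (hfin : ∫⁻ y, v y ∂(intensity r ν) ≠ ⊤) :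
    ∫⁻ ω, prodBound v ω ∂(sampleLaw r ν) < ⊤ := by
  unfold prodBound
  rw [lintegral_iSup (fun K => measurable_prod_comp (g := fun y => 1 + v y)
    (measurable_const.add hv) K)]
  · exact (iSup_le fun K => lintegral_prod_one_add r ν hv hfin K).trans_lt ENNReal.ofReal_lt_top
  · intro K L hKL ω
    exact Finset.prod_le_prod_of_subset_of_one_le' (indices_mono _ hKL) fun i _ _ => le_self_add

/-- Expand the product and keep the constant and linear terms. Thus `prodBound` also controls the
integrals of `v` against the point measure. -/
theorem sum_le_prod_one_add {ι : Type*} (S : Finset ι) (v : ι → ℝ≥0∞) :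
    1 + ∑ i ∈ S, v i ≤ ∏ i ∈ S, (1 + v i) := by
  classical
  induction S using Finset.induction_on with
  | empty => simp
  | insert a S ha ih =>
    rw [Finset.sum_insert ha, Finset.prod_insert ha]
    have h1 : 1 ≤ ∏ i ∈ S, (1 + v i) := le_self_add.trans ih
    calc 1 + (v a + ∑ i ∈ S, v i) = (1 + ∑ i ∈ S, v i) + v a * 1 := by ring
      _ ≤ ∏ i ∈ S, (1 + v i) + v a * ∏ i ∈ S, (1 + v i) := by gcongr
      _ = _ := by ring

theorem lintegral_pointMeasure_le_prodBound {v : E → ℝ≥0∞} (hv : Measurable v) (ω : Sample E) :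
    ∫⁻ y, v y ∂(pointMeasure ω) ≤ prodBound v ω := by
  rw [lintegral_pointMeasure ω hv, ENNReal.tsum_eq_iSup_nat]
  refine iSup_mono fun K => ?_
  refine le_trans ?_ (sum_le_prod_one_add (indices ω.1 K) fun i => v (ω.2 i))
  rw [indices, Finset.sum_sigma]
  exact le_add_self

theorem ae_lintegral_pointMeasure_lt_top {v : E → ℝ≥0∞} (hv : Measurable v)
    (hfin : ∫⁻ y, v y ∂(intensity r ν) ≠ ⊤) :
    ∀ᵐ ω ∂(sampleLaw r ν), ∫⁻ y, v y ∂(pointMeasure ω) < ⊤ := by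
  filter_upwards [ae_lt_top (measurable_prodBound hv)
    (lintegral_prodBound_lt_top r ν hv hfin).ne] with ω hω
  exact (lintegral_pointMeasure_le_prodBound hv ω).trans_lt hω

/-- The point measure does not charge sets which are null for the intensity. -/
theorem ae_pointMeasure_eq_zero {B : Set E} (hB : MeasurableSet B)
    (h0 : intensity r ν B = 0) : ∀ᵐ ω ∂(sampleLaw r ν), pointMeasure ω B = 0 := by
  -- The function `∞ · 1_B` has integral zero for the intensity, while its integral against the
  -- point measure is finite only if `B` contains no point.
  have hm : Measurable (B.indicator fun _ => (⊤ : ℝ≥0∞)) := measurable_const.indicator hB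
  have hfin : ∫⁻ y, B.indicator (fun _ => (⊤ : ℝ≥0∞)) y ∂(intensity r ν) ≠ ⊤ := by
    rw [lintegral_indicator_const hB, h0]; simp
  filter_upwards [ae_lintegral_pointMeasure_lt_top r ν hm hfin] with ω hω
  rw [lintegral_indicator_const hB] at hω
  by_contra hne
  rw [ENNReal.top_mul hne] at hω
  exact lt_irrefl _ hω

/-- If `v` is finite and `∫ min(v, 1)` is finite then `∫ v` is finite, for a point measure. -/
theorem lintegral_pointMeasure_lt_top_of_min {v : E → ℝ≥0∞} (hv : Measurable v)
    (hvtop : ∀ y, v y ≠ ⊤) (ω : Sample E)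
    (h : ∫⁻ y, min (v y) 1 ∂(pointMeasure ω) < ⊤) : ∫⁻ y, v y ∂(pointMeasure ω) < ⊤ := by
  have key : ∀ u : E → ℝ≥0∞, Measurable u → ∫⁻ y, u y ∂(pointMeasure ω) =
      ∑' i : (k : ℕ) × Fin (ω.1 k), u (ω.2 ⟨i.1, i.2⟩) := fun u hu => by
    rw [lintegral_pointMeasure ω hu, ENNReal.tsum_sigma']
    refine tsum_congr fun k => ?_
    rw [tsum_fintype, Finset.sum_range]
  rw [key v hv]
  rw [key _ (hv.min measurable_const)] at h
  -- A convergent sum has only finitely many terms `≥ 1`; at all other points the truncation changes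
  -- nothing.
  have hf : {i : (k : ℕ) × Fin (ω.1 k) | 1 ≤ min (v (ω.2 ⟨i.1, i.2⟩)) 1}.Finite :=
    ENNReal.finite_const_le_of_tsum_ne_top h.ne one_ne_zero
  set F := hf.toFinset
  have hle : ∀ i : (k : ℕ) × Fin (ω.1 k), v (ω.2 ⟨i.1, i.2⟩) ≤
      min (v (ω.2 ⟨i.1, i.2⟩)) 1 + (F : Set _).indicator (fun i => v (ω.2 ⟨i.1, i.2⟩)) i := by
    intro i
    by_cases hi : 1 ≤ v (ω.2 ⟨i.1, i.2⟩)
    · rw [indicator_of_mem (by simpa [F] using hi)]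
      exact le_add_self
    · rw [min_eq_left (not_le.1 hi).le]
      exact le_self_add
  refine (ENNReal.tsum_le_tsum hle).trans_lt ?_
  rw [ENNReal.tsum_add, ← tsum_subtype (F : Set _) fun i : (k : ℕ) × Fin (ω.1 k) => v (ω.2 ⟨i.1, i.2⟩)]
  refine ENNReal.add_lt_top.2 ⟨h, ?_⟩
  rw [Finset.tsum_subtype' F fun i : (k : ℕ) × Fin (ω.1 k) => v (ω.2 ⟨i.1, i.2⟩)]
  exact ENNReal.sum_lt_top.2 fun i _ => (hvtop _).lt_top

theorem enorm_finset_prod {ι : Type*} (S : Finset ι) (f : ι → ℂ) :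
    ‖∏ i ∈ S, f i‖ₑ = ∏ i ∈ S, ‖f i‖ₑ := by
  classical
  induction S using Finset.induction_on with
  | empty => simp
  | insert a S ha ih => rw [Finset.prod_insert ha, Finset.prod_insert ha, enorm_mul, ih]

theorem integral_prod_indices {u : E → ℂ} (hu : Measurable u)
    (hint : Integrable (fun y => u y - 1) (intensity r ν)) (K : ℕ) :
    ∫ ω, ∏ i ∈ indices ω.1 K, u (ω.2 i) ∂(sampleLaw r ν) =
      Complex.exp (∑ k ∈ Finset.range K, ∫ y, (u y - 1) ∂((r k : ℝ≥0∞) • ν k)) := by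
  have hv : Measurable fun y => ‖u y - 1‖ₑ := (hu.sub_const 1).enorm
  have hfin : ∫⁻ y, ‖u y - 1‖ₑ ∂(intensity r ν) ≠ ⊤ := hint.2.ne
  have hI : Integrable (fun ω : Sample E => ∏ i ∈ indices ω.1 K, u (ω.2 i)) (sampleLaw r ν) := by
    refine ⟨(measurable_prod_comp hu K).aestronglyMeasurable, ?_⟩
    refine lt_of_le_of_lt ?_ (lintegral_prodBound_lt_top r ν hv hfin)
    refine lintegral_mono fun ω => le_trans ?_ (le_iSup _ K)
    rw [enorm_finset_prod]
    refine Finset.prod_le_prod' fun i _ => ?_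
    calc ‖u (ω.2 i)‖ₑ = ‖1 + (u (ω.2 i) - 1)‖ₑ := by ring_nf
      _ ≤ ‖(1 : ℂ)‖ₑ + ‖u (ω.2 i) - 1‖ₑ := enorm_add_le _ _
      _ = _ := by simp
  rw [sampleLaw] at hI ⊢
  rw [integral_prod _ hI]
  have h1 : ∀ n : ℕ → ℕ, ∫ x, ∏ i ∈ indices n K, u (x i)
      ∂(Measure.infinitePi fun i : (_ : ℕ) × ℕ => ν i.1) =
      ∏ k ∈ Finset.range K, (∫ y, u y ∂(ν k)) ^ (n k) := fun n => by
    rw [integral_prod_infinitePi (fun i : (_ : ℕ) × ℕ => ν i.1) (indices n K)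
      (g := fun _ y => u y) fun _ => hu, indices, Finset.prod_sigma]
    simp
  simp_rw [h1]
  rw [integral_prod_infinitePi (fun k => poissonMeasure (r k)) (Finset.range K)
    (g := fun k n => (∫ y, u y ∂(ν k)) ^ n) fun _ => measurable_of_countable _]
  simp_rw [integral_pow_poissonMeasure]
  rw [← Complex.exp_sum]
  congr 1
  refine Finset.sum_congr rfl fun k _ => ?_
  rw [integral_smul_measure]
  -- If `r k = 0` the hypothesis says nothing about integrability of `u` under `ν k`, but the factor
  -- `r k` makes both sides vanish.
  rcases eq_or_ne (r k) 0 with h0 | h0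
  · simp [h0]
  have hk : Integrable (fun y => u y - 1) (ν k) := by
    have := hint.mono_measure (Measure.le_sum (fun k => (r k : ℝ≥0∞) • ν k) k)
    rwa [integrable_smul_measure (by simpa using h0) (by simp)] at this
  have hk' : Integrable u (ν k) := by
    refine (hk.add (integrable_const (1 : ℂ))).congr (Eventually.of_forall fun y => ?_)
    simp
  rw [integral_sub hk' (integrable_const 1)]
  simp

/-- **Campbell's formula** for exponential functionals of a Poisson point measure. -/
theorem integral_exp_integral_pointMeasure {h : E → ℂ} (hh : Measurable h)
    (hint : Integrable (fun y => Complex.exp (h y) - 1) (intensity r ν))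
    (hN : ∀ᵐ ω ∂(sampleLaw r ν), Integrable h (pointMeasure ω)) :
    Integrable (fun ω => Complex.exp (∫ y, h y ∂(pointMeasure ω))) (sampleLaw r ν) ∧
    ∫ ω, Complex.exp (∫ y, h y ∂(pointMeasure ω)) ∂(sampleLaw r ν) =
      Complex.exp (∫ y, (Complex.exp (h y) - 1) ∂(intensity r ν)) := by
  set u : E → ℂ := fun y => Complex.exp (h y) with hu_def
  have hu : Measurable u := Complex.measurable_exp.comp hh
  have hv : Measurable fun y => ‖u y - 1‖ₑ := (hu.sub_const 1).enorm
  have hfin : ∫⁻ y, ‖u y - 1‖ₑ ∂(intensity r ν) ≠ ⊤ := hint.2.ne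
  set F : ℕ → Sample E → ℂ := fun K ω => ∏ i ∈ indices ω.1 K, u (ω.2 i) with hF
  -- Since `|u| ≤ 1 + |u - 1|`, this dominates all partial products at once.
  set W : Sample E → ℝ := fun ω => (prodBound (fun y => ‖u y - 1‖ₑ) ω).toReal
  have hWlt := lintegral_prodBound_lt_top r ν hv hfin
  have hW : Integrable W (sampleLaw r ν) :=
    integrable_toReal_of_lintegral_ne_top (measurable_prodBound hv).aemeasurable hWlt.ne
  have hbound : ∀ K, ∀ᵐ ω ∂(sampleLaw r ν), ‖F K ω‖ ≤ W ω := by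
    intro K
    filter_upwards [ae_lt_top (measurable_prodBound hv) hWlt.ne] with ω hω
    rw [← toReal_enorm]
    refine ENNReal.toReal_mono hω.ne (le_trans ?_ (le_iSup _ K))
    rw [enorm_finset_prod]
    refine Finset.prod_le_prod' fun i _ => ?_
    calc ‖u (ω.2 i)‖ₑ = ‖1 + (u (ω.2 i) - 1)‖ₑ := by ring_nf
      _ ≤ ‖(1 : ℂ)‖ₑ + ‖u (ω.2 i) - 1‖ₑ := enorm_add_le _ _
      _ = _ := by simp
  have hlim : ∀ᵐ ω ∂(sampleLaw r ν), Tendsto (fun K => F K ω) atTop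
      (𝓝 (Complex.exp (∫ y, h y ∂(pointMeasure ω)))) := by
    filter_upwards [hN] with ω hω
    have h1 := (hasSum_integral_measure hω).tendsto_sum_nat
    have h2 : ∀ K, F K ω = Complex.exp (∑ k ∈ Finset.range K,
        ∫ y, h y ∂(∑ j ∈ Finset.range (ω.1 k), Measure.dirac (ω.2 ⟨k, j⟩))) := fun K => by
      rw [hF, hu_def]
      simp only
      rw [← Complex.exp_sum, indices, Finset.sum_sigma]
      congr 1
      refine Finset.sum_congr rfl fun k _ => ?_
      rw [integral_finsetSum_measure fun j _ => ?_]
      · exact Finset.sum_congr rfl fun j _ =>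
          (integral_dirac' _ _ hh.stronglyMeasurable).symm
      · exact integrable_dirac' hh.stronglyMeasurable (by simp)
    simp_rw [h2]
    exact (Complex.continuous_exp.tendsto _).comp h1
  have hmeas : ∀ K, AEStronglyMeasurable (F K) (sampleLaw r ν) := fun K =>
    (measurable_prod_comp hu K).aestronglyMeasurable
  have hmeas' := aestronglyMeasurable_of_tendsto_ae atTop hmeas hlim
  refine ⟨?_, ?_⟩
  · refine hW.mono' hmeas' ?_
    filter_upwards [hlim, ae_all_iff.2 hbound] with ω h1 h2
    exact le_of_tendsto h1.norm (Eventually.of_forall h2)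
  · have hT := tendsto_integral_of_dominated_convergence W hmeas hW hbound hlim
    refine tendsto_nhds_unique hT ?_
    simp_rw [hF, integral_prod_indices r ν hu hint]
    exact (Complex.continuous_exp.tendsto _).comp (hasSum_integral_measure hint).tendsto_sum_nat

/-- If no value of `f` is charged by the batches, the values of `f` at the points differ. -/
theorem ae_distinct {Z : Type*} [MeasurableSpace Z] [MeasurableEq Z] {f : E → Z}
    (hf : Measurable f) (h0 : ∀ z, intensity r ν (f ⁻¹' {z}) = 0) :
    ∀ᵐ ω ∂(sampleLaw r ν), ∀ i i' : (_ : ℕ) × ℕ, i ≠ i' → i.2 < ω.1 i.1 → 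
      f (ω.2 i) ≠ f (ω.2 i') := by
  simp_rw [ae_all_iff]
  intro i i' hne
  -- When `r i.1 = 0`, `ν i.1` may charge fibres of `f`, but the batch is almost surely empty and
  -- the position `i` is not used.
  rcases eq_or_ne (r i.1) 0 with hr | hr
  · have h1 : ∀ᵐ n ∂(poissonMeasure (r i.1)), n = 0 := by
      rw [hr, poissonMeasure_zero, ae_dirac_iff (p := fun n => n = 0) (measurableSet_singleton 0)]
    have h2 := (measurePreserving_eval_infinitePi (fun k => poissonMeasure (r k)) i.1
      ).quasiMeasurePreserving.ae h1
    have h3 := (Measure.quasiMeasurePreserving_fst (μ := Measure.infinitePi fun k => poissonMeasure (r k))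
      (ν := Measure.infinitePi fun i : (_ : ℕ) × ℕ => ν i.1)).ae h2
    filter_upwards [h3] with ω hω hlt
    simp only [Function.eval] at hω
    omega
  · have hz : ∀ z, ν i.1 (f ⁻¹' {z}) = 0 := fun z => by
      have := Measure.sum_apply_eq_zero.1 (h0 z) i.1
      rw [Measure.smul_apply, smul_eq_mul, mul_eq_zero] at this
      exact this.resolve_left (by simpa using hr)
    have hD : MeasurableSet {p : E × E | f p.1 = f p.2} :=
      measurableSet_eq_fun (hf.comp measurable_fst) (hf.comp measurable_snd)
    -- By Fubini: for a fixed second point, the first one would have to lie in a single fibre of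
    -- `f`, which is null for `ν i.1`.
    have h1 : ∀ᵐ p ∂((ν i.1).prod (ν i'.1)), f p.1 ≠ f p.2 := by
      rw [ae_iff]
      simp only [not_not]
      rw [Measure.prod_apply_symm hD]
      simp only [lintegral_eq_zero_iff (measurable_measure_prodMk_right hD)]
      exact Eventually.of_forall fun y => hz (f y)
    rw [← Measure.infinitePi_map_eval_prod (P := fun i : (_ : ℕ) × ℕ => ν i.1) hne] at h1
    have h2 := ae_of_ae_map (by fun_prop) h1
    have h3 := (Measure.quasiMeasurePreserving_snd (μ := Measure.infinitePi fun k => poissonMeasure (r k))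
      (ν := Measure.infinitePi fun i : (_ : ℕ) × ℕ => ν i.1)).ae h2
    filter_upwards [h3] with ω hω _
    exact hω

end PointMeasure

end PoissonRandom

end

set_option linter.unusedSectionVars false

noncomputable section

open Filter Topology
open scoped ENNReal NNReal CompactlySupported

namespace CRM

-- The vague topology, its Borel sets, and uniqueness of the Fourier transform.

section Vague

instance {X : Type*} [TopologicalSpace X] [MeasurableSpace X] (η : RadonMeasure X) :
    IsFiniteMeasureOnCompacts η.1 := η.2

variable {X : Type*} [TopologicalSpace X] [PolishSpace X] [LocallyCompactSpace X]
  [MeasurableSpace X] [BorelSpace X]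

theorem integrable_radon (f : C_c(X, ℝ)) (η : RadonMeasure X) : Integrable (fun x => f x) η.1 :=
  f.continuous.integrable_of_hasCompactSupport f.hasCompactSupport

theorem continuous_integral_radon (f : C_c(X, ℝ)) :
    Continuous fun η : RadonMeasure X => ∫ x, f x ∂η.1 :=
  continuous_iff_le_induced.2
    (iInf_le (fun f : C_c(X, ℝ) => TopologicalSpace.induced
      (fun η : RadonMeasure X => ∫ x, f x ∂η.1) inferInstance) f)

theorem measurable_integral_radon (f : C_c(X, ℝ)) :
    Measurable fun η : RadonMeasure X => ∫ x, f x ∂η.1 :=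
  (continuous_integral_radon f).measurable

theorem exists_bump (K : Set X) (hK : IsCompact K) :
    ∃ φ : C_c(X, ℝ), (∀ x ∈ K, φ x = 1) ∧ ∀ x, 0 ≤ φ x ∧ φ x ≤ 1 := by
  obtain ⟨f, h1, h2, -, h3⟩ := exists_continuousMap_one_of_isCompact_subset_isOpen hK isOpen_univ
    (subset_univ K)
  exact ⟨⟨f, h2⟩, fun x hx => h1 hx, fun x => h3 x⟩

/-- Test functions supported in a compact set are uniformly approximated by countably many. -/
theorem exists_dense_seq (K : Set X) (hK : IsCompact K) :
    ∃ g : ℕ → C_c(X, ℝ), (∀ k, ∀ x ∉ K, g k x = 0) ∧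
      ∀ f : C_c(X, ℝ), (∀ x ∉ K, f x = 0) → ∀ δ : ℝ, 0 < δ → ∃ k, ∀ x, |g k x - f x| ≤ δ := by
  let T : Set C(X, ℝ) := {f | ∀ x ∉ K, f x = 0}
  have : Nonempty T := ⟨⟨0, fun _ _ => rfl⟩⟩
  -- Compact-open neighbourhoods tested on `K` give uniform closeness on `K`; off `K` all functions
  -- in `T` vanish, so closeness is uniform on `X`.
  obtain ⟨d, hd⟩ := TopologicalSpace.exists_dense_seq T
  refine ⟨fun k => ⟨(d k).1, HasCompactSupport.intro hK (d k).2⟩, fun k => (d k).2, ?_⟩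
  intro f hf δ hδ
  let f' : T := ⟨f.toContinuousMap, hf⟩
  have hopen : IsOpen {g : C(X, ℝ) | MapsTo (g - f'.1) K (Metric.ball 0 δ)} :=
    (ContinuousMap.isOpen_setOfPred_mapsTo hK Metric.isOpen_ball).preimage
      (continuous_id.sub continuous_const)
  have hopen' := hopen.preimage (continuous_subtype_val : Continuous (Subtype.val : T → C(X, ℝ)))
  obtain ⟨k, hk⟩ := hd.exists_mem_open hopen' ⟨f', by
    intro x _
    simp [hδ]⟩
  refine ⟨k, fun x => ?_⟩
  by_cases hx : x ∈ K
  · have := hk hx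
    rw [mem_ball_zero_iff, Real.norm_eq_abs] at this
    exact this.le
  · have h1 : (d k).1 x = 0 := (d k).2 x hx
    change |(d k).1 x - f x| ≤ δ
    rw [h1, hf x hx]
    simpa using hδ.le

/-- The vague topology is induced by countably many test functions. -/
theorem exists_countable_family (X : Type*) [TopologicalSpace X] [PolishSpace X]
    [LocallyCompactSpace X] [MeasurableSpace X] [BorelSpace X] : ∃ F : ℕ → C_c(X, ℝ),
    vagueTopology X = TopologicalSpace.induced
      (fun (η : RadonMeasure X) (n : ℕ) => ∫ x, F n x ∂η.1) inferInstance := by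
  let K : CompactExhaustion X := default
  choose φ hφ1 hφ using fun n => exists_bump (K n) (K.isCompact n)
  choose g hg0 hg using fun n => exists_dense_seq (K n) (K.isCompact n)
  -- Index `(n, 0)` is the bump on `K n` and `(n, k + 1)` is `g n k`. The bumps are needed to bound
  -- the mass of `K n` near a given measure, so that uniformly close functions have close integrals.
  let F' : ℕ × ℕ → C_c(X, ℝ) := fun p => Nat.casesOn p.2 (φ p.1) (g p.1)
  refine ⟨fun n => F' n.unpair, le_antisymm ?_ ?_⟩
  · rw [← continuous_iff_le_induced]
    exact continuous_pi fun n => continuous_integral_radon _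
  · set τ : TopologicalSpace (RadonMeasure X) := TopologicalSpace.induced
      (fun (η : RadonMeasure X) (n : ℕ) => ∫ x, F' n.unpair x ∂η.1) inferInstance
    have hF : ∀ p, @Continuous _ _ τ _ fun η : RadonMeasure X => ∫ x, F' p x ∂η.1 := fun p => by
      have h := @Continuous.comp _ _ _ τ _ _ _ _ (continuous_apply (Nat.pair p.1 p.2))
        (continuous_induced_dom (f := fun (η : RadonMeasure X) (n : ℕ) => ∫ x, F' n.unpair x ∂η.1))
      simpa [Function.comp_def] using h
    refine le_iInf fun f => ?_
    rw [← continuous_iff_le_induced]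
    rw [@continuous_iff_continuousAt _ _ τ]
    intro η₀
    obtain ⟨n, hn⟩ := K.exists_superset_of_isCompact f.hasCompactSupport
    have hf0 : ∀ x ∉ K n, f x = 0 := fun x hx => by
      by_contra h
      exact hx (hn (subset_tsupport _ h))
    rw [ContinuousAt, Metric.tendsto_nhds]
    intro ε hε
    -- The extra `1` makes `M` a bound in a whole neighbourhood of `η₀`. With precision `ε / (4 *
    -- M)`, replacing `f` by `g n k` at `η` and at `η₀` and moving from `η` to `η₀` cost at most `ε
    -- / 4` each.
    set M : ℝ := ∫ x, φ n x ∂η₀.1 + 1 with hM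
    have hM0 : 0 < M := by
      have : 0 ≤ ∫ x, φ n x ∂η₀.1 := integral_nonneg fun x => (hφ n x).1
      linarith
    obtain ⟨k, hk⟩ := hg n f hf0 (ε / (4 * M)) (by positivity)
    have happ : ∀ η : RadonMeasure X, |∫ x, g n k x ∂η.1 - ∫ x, f x ∂η.1| ≤
        ε / (4 * M) * ∫ x, φ n x ∂η.1 := fun η => by
      rw [← integral_sub (integrable_radon _ η) (integrable_radon _ η), ← integral_const_mul]
      refine (abs_integral_le_integral_abs).trans (integral_mono_of_nonneg
        (Eventually.of_forall fun x => abs_nonneg _) ((integrable_radon (φ n) η).const_mul _)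
        (Eventually.of_forall fun x => ?_))
      by_cases hx : x ∈ K n
      · simp only [hφ1 n x hx, mul_one]
        exact hk x
      · simp only [hg0 n k x hx, hf0 x hx, sub_self, abs_zero]
        exact mul_nonneg (by positivity) (hφ n x).1
    have e1 : ∀ᶠ η in @nhds _ τ η₀, ∫ x, φ n x ∂η.1 < M :=
      ((@continuous_iff_continuousAt _ _ τ _ _).1 (hF (n, 0)) η₀).eventually_lt_const
        (show ∫ x, φ n x ∂η₀.1 < M by linarith)
    have e2 : ∀ᶠ η in @nhds _ τ η₀, dist (∫ x, g n k x ∂η.1) (∫ x, g n k x ∂η₀.1) < ε / 4 :=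
      (Metric.tendsto_nhds.1 ((@continuous_iff_continuousAt _ _ τ _ _).1 (hF (n, k + 1)) η₀)) _
        (by positivity)
    filter_upwards [e1, e2] with η h1 h2
    have a1 := happ η
    have a2 := happ η₀
    have b : ∀ y < M, ε / (4 * M) * y ≤ ε / 4 := fun y hy => by
      calc ε / (4 * M) * y ≤ ε / (4 * M) * M := by gcongr
        _ = ε / 4 := by field_simp
    have b1 := b _ h1
    have b2 := b (∫ x, φ n x ∂η₀.1) (by linarith)
    rw [Real.dist_eq] at h2 ⊢
    rw [abs_le] at a1 a2
    rw [abs_lt] at h2 ⊢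
    constructor <;> linarith [a1.1, a1.2, a2.1, a2.2, h2.1, h2.2]

/-- Countability is what matters: on `ℕ → ℝ` the Borel and product `σ`-algebras agree, so vague
Borel measurability may be tested on integrals of test functions. -/
theorem exists_vagueBorel_eq_comap (X : Type*) [TopologicalSpace X] [PolishSpace X]
    [LocallyCompactSpace X] [MeasurableSpace X] [BorelSpace X] : ∃ F : ℕ → C_c(X, ℝ),
    vagueBorel X = MeasurableSpace.comap
      (fun (η : RadonMeasure X) (n : ℕ) => ∫ x, F n x ∂η.1) MeasurableSpace.pi := by
  obtain ⟨F, hF⟩ := exists_countable_family X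
  refine ⟨F, ?_⟩
  rw [vagueBorel, hF, borel_comap, BorelSpace.measurable_eq (α := ℕ → ℝ)]

theorem measurable_radon_iff {Ω : Type*} [MeasurableSpace Ω] {G : Ω → RadonMeasure X} :
    Measurable G ↔ ∀ f : C_c(X, ℝ), Measurable fun ω => ∫ x, f x ∂(G ω).1 := by
  refine ⟨fun h f => (measurable_integral_radon f).comp h, fun h => ?_⟩
  obtain ⟨F, hF⟩ := exists_vagueBorel_eq_comap X
  rw [hF, measurable_comap_iff]
  exact measurable_pi_lambda _ fun n => h (F n)

/-- Finite measures on the space of Radon measures are determined by their Fourier transform. -/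
theorem ext_of_fourier {μ ν : Measure (RadonMeasure X)} [IsFiniteMeasure μ] [IsFiniteMeasure ν]
    (h : ∀ f : C_c(X, ℝ), ∫ η : RadonMeasure X, Complex.exp (Complex.I * ((∫ x, f x ∂η.1 : ℝ) : ℂ)) ∂μ
      = ∫ η : RadonMeasure X, Complex.exp (Complex.I * ((∫ x, f x ∂η.1 : ℝ) : ℂ)) ∂ν) :
    μ = ν := by
  obtain ⟨F, hF⟩ := exists_vagueBorel_eq_comap X
  set Φ : RadonMeasure X → ℕ → ℝ := fun η n => ∫ x, F n x ∂η.1 with hΦ_def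
  have hΦ : Measurable Φ := measurable_pi_lambda _ fun n => measurable_integral_radon _
  have key : μ.map Φ = ν.map Φ := by
    refine IsProjectiveLimit.unique (P := fun I => (ν.map Φ).map I.restrict) (fun I => ?_)
      (fun I => rfl)
    have hr : Measurable (I.restrict : (ℕ → ℝ) → I → ℝ) :=
      measurable_pi_lambda _ fun _ => measurable_pi_apply _
    change _ = (ν.map Φ).map I.restrict
    rw [Measure.map_map hr hΦ, Measure.map_map hr hΦ]
    refine Measure.ext_of_charFunDual (funext fun L => ?_)
    -- A linear combination of finitely many coordinates is the integral of one test function, so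
    -- the hypothesis gives all characteristic functions of the finite-dimensional marginals.
    have hL : ∀ η : RadonMeasure X, L ((I.restrict ∘ Φ) η) =
        ∫ x, (∑ i : I, L (Pi.single i 1) • F i) x ∂η.1 := fun η => by
      have h1 : ∀ x, (∑ i : I, L (Pi.single i 1) • F i) x = ∑ i : I, L (Pi.single i 1) * F i x :=
        fun x => by simp [CompactlySupportedContinuousMap.sum_apply]
      simp_rw [h1]
      have h2 : ∀ i : I, Integrable (fun x => L (Pi.single i 1) * F i x) η.1 := fun i =>
        (integrable_radon (F i) η).const_mul _
      rw [integral_finsetSum _ fun i _ => h2 i]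
      simp_rw [integral_const_mul]
      conv_lhs => rw [← LinearMap.sum_single_apply (fun _ : I => ℝ) ((I.restrict ∘ Φ) η)]
      rw [map_sum]
      refine Finset.sum_congr rfl fun i _ => ?_
      have : (Pi.single i ((I.restrict ∘ Φ) η i) : I → ℝ) = (Φ η i) • Pi.single i 1 := by
        rw [← Pi.single_smul]; simp [Finset.restrict]
      rw [this, map_smul, smul_eq_mul, mul_comm]
    have hm : ∀ ρ : Measure (RadonMeasure X), charFunDual (ρ.map (I.restrict ∘ Φ)) L =
        ∫ η : RadonMeasure X, Complex.exp (Complex.I *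
          ((∫ x, (∑ i : I, L (Pi.single i 1) • F i) x ∂η.1 : ℝ) : ℂ)) ∂ρ := fun ρ => by
      rw [charFunDual_apply, integral_map (hr.comp hΦ).aemeasurable
        (Continuous.aestronglyMeasurable (by fun_prop))]
      simp_rw [hL, mul_comm]
    rw [hm, hm]
    exact h _
  refine Measure.ext fun s hs => ?_
  have hs' : MeasurableSet[MeasurableSpace.comap Φ MeasurableSpace.pi] s := hF ▸ hs
  obtain ⟨t, ht, rfl⟩ := hs'
  rw [← Measure.map_apply hΦ ht, key, Measure.map_apply hΦ ht]

theorem measurable_lintegral_radon (f : C_c(X, ℝ)) (hf : ∀ x, 0 ≤ f x) :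
    Measurable fun η : RadonMeasure X => ∫⁻ x, ENNReal.ofReal (f x) ∂η.1 := by
  have : ∀ η : RadonMeasure X, ∫⁻ x, ENNReal.ofReal (f x) ∂η.1 = ENNReal.ofReal (∫ x, f x ∂η.1) :=
    fun η => (ofReal_integral_eq_lintegral_ofReal (integrable_radon f η)
      (Eventually.of_forall hf)).symm
  simp_rw [this]
  exact (measurable_integral_radon f).ennreal_ofReal

/-- Multiplying by a bump `φ n` makes `η` finite. Closed sets are then reached as limits of
thickened indicators, Borel sets by a π-system argument, and `n → ∞` removes the cutoff. -/
theorem measurable_coe_radon : Measurable fun η : RadonMeasure X => η.1 := by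
  let _ : MetricSpace X := TopologicalSpace.metrizableSpaceMetric X
  let K : CompactExhaustion X := default
  choose φ hφ1 hφ using fun n => exists_bump (K n) (K.isCompact n)
  have hfin : ∀ n (η : RadonMeasure X),
      IsFiniteMeasure (η.1.withDensity fun x => ENNReal.ofReal (φ n x)) := fun n η =>
    isFiniteMeasure_withDensity_ofReal (integrable_radon (φ n) η).2
  have hφm : ∀ n, Measurable fun x => ENNReal.ofReal (φ n x) := fun n =>
    (φ n).continuous.measurable.ennreal_ofReal
  have h1 : ∀ n, Measurable fun η : RadonMeasure X =>
      η.1.withDensity fun x => ENNReal.ofReal (φ n x) := fun n => by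
    have hmul : ∀ g : C(X, ℝ), (∀ x, 0 ≤ g x) → Measurable fun η : RadonMeasure X =>
        ∫⁻ x, ENNReal.ofReal (g x) ∂(η.1.withDensity fun x => ENNReal.ofReal (φ n x)) := by
      intro g hg
      let f : C_c(X, ℝ) := ⟨⟨fun x => φ n x * g x, (φ n).continuous.mul g.continuous⟩,
        (φ n).hasCompactSupport.mul_right⟩
      have h2 := measurable_lintegral_radon f fun x => mul_nonneg (hφ n x).1 (hg x)
      convert! h2 using 2 with η
      rw [lintegral_withDensity_eq_lintegral_mul _ (hφm n) g.continuous.measurable.ennreal_ofReal]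
      refine lintegral_congr fun x => ?_
      simp [f, ENNReal.ofReal_mul (hφ n x).1]
    have hclosed : ∀ s : Set X, IsClosed s → Measurable fun η : RadonMeasure X =>
        (η.1.withDensity fun x => ENNReal.ofReal (φ n x)) s := by
      intro s hs
      have hpos : ∀ k : ℕ, (0 : ℝ) < 1 / (k + 1) := fun k => by positivity
      refine measurable_of_tendsto_metrizable
        (f := fun (k : ℕ) (η : RadonMeasure X) => ∫⁻ x, (thickenedIndicator (hpos k) s x : ℝ≥0∞)
          ∂(η.1.withDensity fun x => ENNReal.ofReal (φ n x))) (fun k => ?_) ?_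
      · have := hmul ⟨fun x => (thickenedIndicator (hpos k) s x : ℝ),
          NNReal.continuous_coe.comp (thickenedIndicator (hpos k) s).continuous⟩
          fun x => NNReal.coe_nonneg _
        simpa using this
      · rw [tendsto_pi_nhds]
        exact fun η => tendsto_lintegral_thickenedIndicator_of_isClosed _ hs hpos
          tendsto_one_div_add_atTop_nhds_zero_nat
    refine Measurable.measure_of_isPiSystem (S := {s | IsClosed s}) ?_ isPiSystem_isClosed
      hclosed (hclosed univ isClosed_univ)
    rw [BorelSpace.measurable_eq (α := X), borel_eq_generateFrom_isClosed]
  refine Measure.measurable_of_measurable_coe _ fun A hA => ?_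
  have h2 : ∀ η : RadonMeasure X, η.1 A =
      ⨆ n, (η.1.withDensity fun x => ENNReal.ofReal (φ n x)) (A ∩ K n) := fun η => by
    have h3 : ∀ n, (η.1.withDensity fun x => ENNReal.ofReal (φ n x)) (A ∩ K n) = η.1 (A ∩ K n) :=
      fun n => by
      have hm := hA.inter (K.isCompact n).measurableSet
      rw [withDensity_apply _ hm, setLIntegral_congr_fun (g := fun _ => 1) hm fun x hx => by
        simp [hφ1 n x hx.2], setLIntegral_one]
    simp_rw [h3]
    have hmono : Monotone fun n => A ∩ K n := fun a b hab =>
      inter_subset_inter_right _ (K.subset hab)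
    rw [← hmono.measure_iUnion, ← inter_iUnion, K.iUnion_eq, inter_univ]
  simp_rw [h2]
  exact Measurable.iSup fun n =>
    (Measure.measurable_coe (hA.inter (K.isCompact n).measurableSet)).comp (h1 n)

/-- The tautological kernel from Radon measures on `X` to `X`. -/
def radonKernel (X : Type*) [TopologicalSpace X] [PolishSpace X] [LocallyCompactSpace X]
    [MeasurableSpace X] [BorelSpace X] : Kernel (RadonMeasure X) X where
  toFun η := η.1
  measurable' := measurable_coe_radon

/-- The mass of `K n` is finite for each `η` but not uniformly in `η`. Splitting also according to
the integer part `j` of `η (K n)` gives pieces bounded by `j + 1`. -/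
instance : IsSFiniteKernel (radonKernel X) := by
  let K : CompactExhaustion X := default
  have hK : ∀ n, MeasurableSet (K n) := fun n => (K.isCompact n).measurableSet
  have hB : ∀ n, MeasurableSet (disjointed K n) := fun n => MeasurableSet.disjointed hK n
  have hS : ∀ n j, MeasurableSet {η : RadonMeasure X | ⌊(η.1 (K n)).toReal⌋₊ = j} := fun n j =>
    measurableSet_eq_fun (Nat.measurable_floor.comp
      (((Measure.measurable_coe (hK n)).comp measurable_coe_radon).ennreal_toReal)) measurable_const
  classical
  let κ : ℕ × ℕ → Kernel (RadonMeasure X) X := fun p =>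
    Kernel.piecewise (hS p.1 p.2) ((radonKernel X).restrict (hB p.1)) 0
  have hfin : ∀ p, IsFiniteKernel (κ p) := fun p => by
    refine ⟨ENNReal.ofReal (p.2 + 1), ENNReal.ofReal_lt_top, fun η => ?_⟩
    rw [Kernel.piecewise_apply]
    split_ifs with h
    · rw [Kernel.restrict_apply, Measure.restrict_apply_univ]
      have h1 : η.1 (disjointed K p.1) ≤ η.1 (K p.1) := measure_mono (disjointed_subset _ _)
      refine h1.trans ?_
      rw [← ENNReal.ofReal_toReal (K.isCompact p.1).measure_lt_top.ne]
      refine ENNReal.ofReal_le_ofReal ?_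
      have h2 := Nat.lt_floor_add_one (η.1 (K p.1)).toReal
      rw [show ⌊(η.1 (K p.1)).toReal⌋₊ = p.2 from h] at h2
      exact h2.le
    · simp
  have hsum : radonKernel X = Kernel.sum κ := by
    ext η A hA
    rw [Kernel.sum_apply' _ _ hA, ENNReal.tsum_prod']
    have h1 : ∀ n, ∑' j, κ (n, j) η A = η.1 (A ∩ disjointed K n) := fun n => by
      rw [tsum_eq_single ⌊(η.1 (K n)).toReal⌋₊]
      · rw [Kernel.piecewise_apply, if_pos (by exact rfl), Kernel.restrict_apply,
          Measure.restrict_apply hA]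
        rfl
      · intro j hj
        rw [Kernel.piecewise_apply, if_neg (by exact hj.symm)]
        simp
    simp_rw [h1]
    rw [← measure_iUnion, ← inter_iUnion, iUnion_disjointed, K.iUnion_eq, inter_univ]
    · rfl
    · exact fun i j hij => ((disjoint_disjointed K) hij).mono inter_subset_right inter_subset_right
    · exact fun n => hA.inter (hB n)
  rw [hsum]
  infer_instance

/-- The atom weight is the kernel measure of a section of the diagonal, hence jointly measurable in
the measure and the point. -/
theorem measurable_radon_singleton :
    Measurable fun p : RadonMeasure X × X => p.1.1.real {p.2} := by
  let κ : Kernel (RadonMeasure X × X) X := (radonKernel X).comap Prod.fst measurable_fst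
  have h : Measurable fun p : RadonMeasure X × X =>
      κ p (Prod.mk p ⁻¹' {q : (RadonMeasure X × X) × X | q.2 = q.1.2}) :=
    Kernel.measurable_kernel_prodMk_left
      (measurableSet_eq_fun measurable_snd (measurable_snd.comp measurable_fst))
  exact h.ennreal_toReal

end Vague

-- Measurability of the proposed density.

section Density

variable {X : Type*} [TopologicalSpace X] [PolishSpace X] [LocallyCompactSpace X]
  [MeasurableSpace X] [BorelSpace X]

theorem measurable_logRatio {l : X → ℝ → ℝ} (hl : Measurable (Function.uncurry l))
    (θ : Current X) : Measurable (Function.uncurry (logRatio l θ)) := by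
  have h1 : Measurable fun p : RadonMeasure X × X => p.1.1.real {p.2} := measurable_radon_singleton
  have h2 : Measurable fun p : RadonMeasure X × X => (θ p.2)⁻¹ :=
    (θ.continuous'.measurable.comp measurable_snd).inv
  have h3 : Measurable fun p : RadonMeasure X × X => l p.2 ((θ p.2)⁻¹ * p.1.1.real {p.2}) :=
    hl.comp (measurable_snd.prodMk (h2.mul h1))
  have h4 : Measurable fun p : RadonMeasure X × X => l p.2 (p.1.1.real {p.2}) :=
    hl.comp (measurable_snd.prodMk h1)
  exact (Real.measurable_log.comp (h3.div h4)).mul h1.inv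

theorem measurableSet_posSet {l : X → ℝ → ℝ} (hl : Measurable (Function.uncurry l))
    (hl_pos : ∀ x, (∀ s : ℝ, 0 < s → 0 < l x s) ∨ (∀ s : ℝ, 0 < s → l x s = 0)) :
    MeasurableSet (posSet l) := by
  have : posSet l = {x | 0 < l x 1} := by
    ext x
    refine ⟨fun h => h 1 one_pos, fun h => (hl_pos x).resolve_right fun h0 => ?_⟩
    have : 0 < l x 1 := h
    rw [h0 1 one_pos] at this
    exact lt_irrefl _ this
  rw [this]
  exact measurableSet_lt measurable_const (hl.comp (measurable_id.prodMk measurable_const))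

theorem measurable_currentDensity (σ : Measure X) {l : X → ℝ → ℝ}
    (hl : Measurable (Function.uncurry l)) (hY : MeasurableSet (posSet l)) (θ : Current X) :
    Measurable (currentDensity σ l θ) := by
  refine Real.measurable_exp.comp (Measurable.add_const ?_ _)
  have h := StronglyMeasurable.integral_kernel_prod_right (κ := (radonKernel X).restrict hY)
    (measurable_logRatio hl θ).stronglyMeasurable
  simp_rw [Kernel.restrict_apply] at h
  exact h.measurable

end Density

end CRM

end

noncomputable section

open Filter Topology
open scoped ENNReal NNReal CompactlySupported

namespace PoissonRandom

variable {E : Type*} [MeasurableSpace E]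

/-- Every s-finite measure is the intensity of some Poisson process. -/
theorem exists_intensity_eq [Nonempty E] (m : Measure E) [SFinite m] :
    ∃ (r : ℕ → ℝ≥0) (ν : ℕ → Measure E), (∀ k, IsProbabilityMeasure (ν k)) ∧
      intensity r ν = m := by
  have h : ∀ k, ∃ (c : ℝ≥0) (ρ : Measure E), IsProbabilityMeasure ρ ∧
      (c : ℝ≥0∞) • ρ = sfiniteSeq m k := by
    intro k
    set mk := sfiniteSeq m k
    rcases eq_or_ne mk 0 with h0 | h0
    · exact ⟨0, Measure.dirac (Classical.arbitrary E), inferInstance, by simp [h0]⟩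
    · have hne : mk univ ≠ 0 := by simpa using h0
      have htop : mk univ ≠ ⊤ := measure_ne_top _ _
      refine ⟨(mk univ).toNNReal, (mk univ)⁻¹ • mk, ⟨?_⟩, ?_⟩
      · simp [ENNReal.inv_mul_cancel hne htop]
      · rw [ENNReal.coe_toNNReal htop, smul_smul, ENNReal.mul_inv_cancel hne htop, one_smul]
  choose r ν hν h using h
  refine ⟨r, ν, hν, ?_⟩
  rw [intensity]
  simp_rw [h]
  exact sum_sfiniteSeq m

variable (r : ℕ → ℝ≥0) (ν : ℕ → Measure E) [∀ k, IsProbabilityMeasure (ν k)]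

/-- A truncated moment suffices: it makes the truncated sum finite, and then only finitely many
points have large values. -/
theorem ae_integrable_pointMeasure {F : Type*} [NormedAddCommGroup F] [MeasurableSpace F]
    [BorelSpace F] [SecondCountableTopology F] {h : E → F} (hh : Measurable h)
    (hfin : ∫⁻ y, min ‖h y‖ₑ 1 ∂(intensity r ν) < ⊤) :
    ∀ᵐ ω ∂(sampleLaw r ν), Integrable h (pointMeasure ω) := by
  filter_upwards [ae_lintegral_pointMeasure_lt_top r ν (hh.enorm.min measurable_const) hfin.ne]
    with ω hω
  exact ⟨hh.aestronglyMeasurable, lintegral_pointMeasure_lt_top_of_min hh.enorm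
    (fun y => enorm_ne_top) ω hω⟩

end PoissonRandom

namespace CRM

open PoissonRandom

-- Discrete Radon measures.

section Discrete

variable {X : Type*} [TopologicalSpace X] [PolishSpace X] [LocallyCompactSpace X]
  [MeasurableSpace X] [BorelSpace X]

theorem mem_discreteRadon_of_countable {η : RadonMeasure X} {T : Set X} (hT : T.Countable)
    (h0 : η.1 Tᶜ = 0) : η ∈ discreteRadon X := by
  have hlt : ∀ x, η.1 {x} ≠ ⊤ := fun x => isCompact_singleton.measure_lt_top.ne
  -- `T` may contain points without mass, while the weights in `discreteRadon` have to be positive.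
  set S : Set X := {x ∈ T | η.1 {x} ≠ 0} with hS
  have hSc : S.Countable := hT.mono fun x hx => hx.1
  refine ⟨S, hSc, fun x => (η.1 {(x : X)}).toReal, fun x => ENNReal.toReal_pos x.2.2 (hlt _), ?_⟩
  have hS0 : η.1 Sᶜ = 0 := by
    have hsub : Sᶜ ⊆ Tᶜ ∪ ⋃ x ∈ T \ S, {x} := by
      intro x hx
      by_cases hxT : x ∈ T
      · exact Or.inr (mem_biUnion (show x ∈ T \ S from ⟨hxT, hx⟩) rfl)
      · exact Or.inl hxT
    refine measure_mono_null hsub (measure_union_null h0 ?_)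
    refine (measure_biUnion_null_iff (hT.mono sdiff_subset)).2 fun x hx => ?_
    by_contra hne
    exact hx.2 ⟨hx.1, hne⟩
  have := hSc.to_subtype
  ext A hA
  rw [Measure.sum_apply _ hA]
  have h1 : η.1 A = η.1 (A ∩ S) := by
    have hz : η.1 (A \ S) = 0 := measure_mono_null (fun x hx => hx.2) hS0
    rw [← measure_inter_add_sdiff A hSc.measurableSet, hz, add_zero]
  have h2 : A ∩ S = ⋃ x : S, (A ∩ {(x : X)}) := by
    ext y; simp [mem_iUnion]
  rw [h1, h2, measure_iUnion]
  · refine tsum_congr fun x => ?_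
    rw [ENNReal.ofReal_toReal (hlt _), Measure.smul_apply, Measure.dirac_apply' _ hA, smul_eq_mul]
    by_cases hx : (x : X) ∈ A
    · rw [inter_eq_right.2 (singleton_subset_iff.2 hx), indicator_of_mem hx]; simp
    · rw [inter_singleton_eq_empty.2 hx, indicator_of_notMem hx]; simp
  · intro x y hxy
    refine Disjoint.mono inter_subset_right inter_subset_right ?_
    simpa using fun h => hxy (Subtype.ext h)
  · exact fun x => hA.inter (measurableSet_singleton _)

theorem exists_countable_of_mem_discreteRadon {η : RadonMeasure X} (h : η ∈ discreteRadon X) :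
    ∃ T : Set X, T.Countable ∧ η.1 Tᶜ = 0 := by
  obtain ⟨T, hT, w, -, hη⟩ := h
  refine ⟨T, hT, ?_⟩
  rw [hη, Measure.sum_apply _ hT.measurableSet.compl, ENNReal.tsum_eq_zero]
  intro x
  rw [Measure.smul_apply, Measure.dirac_apply' _ hT.measurableSet.compl]
  simp

/-- A form of discreteness from which measurability in `η` can be read off. For the converse, the
points of positive mass are always countable. -/
theorem mem_discreteRadon_iff {η : RadonMeasure X} :
    η ∈ discreteRadon X ↔ η.1 {x | η.1.real {x} = 0} = 0 := by
  refine ⟨fun h => ?_, fun h => ?_⟩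
  · obtain ⟨T, hT, h0⟩ := exists_countable_of_mem_discreteRadon h
    have hsub : {x | η.1.real {x} = 0} ⊆ Tᶜ ∪ ⋃ x ∈ T ∩ {x | η.1.real {x} = 0}, {x} := by
      intro x hx
      by_cases hxT : x ∈ T
      · exact Or.inr (mem_biUnion (show x ∈ T ∩ {x | η.1.real {x} = 0} from ⟨hxT, hx⟩) rfl)
      · exact Or.inl hxT
    refine measure_mono_null hsub (measure_union_null h0 ?_)
    refine (measure_biUnion_null_iff (hT.mono inter_subset_left)).2 fun x hx => ?_
    exact (ENNReal.toReal_eq_zero_iff _).1 hx.2 |>.resolve_right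
      isCompact_singleton.measure_lt_top.ne
  · have hc : {x | 0 < η.1 {x}}.Countable :=
      Measure.countable_meas_pos_of_disjoint_iUnion (μ := η.1) (As := fun x : X => {x})
        (fun x => measurableSet_singleton x) (fun x y hxy => by simpa using hxy)
    refine mem_discreteRadon_of_countable hc (measure_mono_null (fun x hx => ?_) h)
    have : η.1 {x} = 0 := by simpa using hx
    simp [measureReal_def, this]

theorem measurableSet_discreteRadon : MeasurableSet (discreteRadon X) := by
  have hm : MeasurableSet {p : RadonMeasure X × X | p.1.1.real {p.2} = 0} :=
    measurable_radon_singleton (measurableSet_singleton 0)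
  have h := Kernel.measurable_kernel_prodMk_left (κ := radonKernel X) hm
  have h2 : discreteRadon X = {η | radonKernel X η (Prod.mk η ⁻¹'
      {p : RadonMeasure X × X | p.1.1.real {p.2} = 0}) = 0} := by
    ext η
    exact mem_discreteRadon_iff
  rw [h2]
  exact h (measurableSet_singleton 0)

theorem act_mem_discreteRadon (θ : Current X) {η : RadonMeasure X} (h : η ∈ discreteRadon X) :
    θ.act η ∈ discreteRadon X := by
  obtain ⟨T, hT, h0⟩ := exists_countable_of_mem_discreteRadon h
  exact mem_discreteRadon_of_countable hT (withDensity_absolutelyContinuous _ _ h0)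

end Discrete

-- The completely random measure built from a Poisson process.

section Construction

variable {X : Type*} [TopologicalSpace X] [PolishSpace X] [LocallyCompactSpace X]
  [MeasurableSpace X] [BorelSpace X]

/-- The measure on `X` with an atom of weight `s` at `x` for each point `(x, s)` of a sample. -/
def rawMeasure (ω : Sample (X × ℝ)) : Measure X :=
  ((pointMeasure ω).withDensity fun p => ENNReal.ofReal p.2).map Prod.fst

open Classical in
/-- The measure `rawMeasure ω` if it is a Radon measure, and zero otherwise. -/
def sampleMeasure (ω : Sample (X × ℝ)) : Measure X :=
  if IsFiniteMeasureOnCompacts (rawMeasure ω) then rawMeasure ω else 0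

theorem sampleMeasure_of_finite {ω : Sample (X × ℝ)}
    (h : IsFiniteMeasureOnCompacts (rawMeasure ω)) : sampleMeasure ω = rawMeasure ω :=
  if_pos h

theorem sampleMeasure_of_not_finite {ω : Sample (X × ℝ)}
    (h : ¬ IsFiniteMeasureOnCompacts (rawMeasure ω)) : sampleMeasure ω = 0 :=
  if_neg h

theorem isFiniteMeasureOnCompacts_sampleMeasure (ω : Sample (X × ℝ)) :
    IsFiniteMeasureOnCompacts (sampleMeasure ω) := by
  by_cases h : IsFiniteMeasureOnCompacts (rawMeasure ω)
  · rwa [sampleMeasure_of_finite h]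
  · rw [sampleMeasure_of_not_finite h]
    infer_instance

/-- The Radon measure on `X` built from a sample. -/
def sampleRadon (ω : Sample (X × ℝ)) : RadonMeasure X :=
  ⟨sampleMeasure ω, isFiniteMeasureOnCompacts_sampleMeasure ω⟩

theorem lintegral_rawMeasure (ω : Sample (X × ℝ)) {g : X → ℝ≥0∞} (hg : Measurable g) :
    ∫⁻ x, g x ∂(rawMeasure ω) = ∫⁻ p, ENNReal.ofReal p.2 * g p.1 ∂(pointMeasure ω) := by
  rw [rawMeasure, lintegral_map hg measurable_fst]
  exact lintegral_withDensity_eq_lintegral_mul _ measurable_snd.ennreal_ofReal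
    (hg.comp measurable_fst)

theorem measurable_lintegral_rawMeasure {g : X → ℝ≥0∞} (hg : Measurable g) :
    Measurable fun ω => ∫⁻ x, g x ∂(rawMeasure ω) := by
  simp_rw [fun ω => lintegral_rawMeasure ω hg]
  exact (Measure.measurable_lintegral (measurable_snd.ennreal_ofReal.mul
    (hg.comp measurable_fst))).comp measurable_pointMeasure

theorem isFiniteMeasureOnCompacts_iff (ρ : Measure X) (K : CompactExhaustion X) :
    IsFiniteMeasureOnCompacts ρ ↔ ∀ n, ρ (K n) < ⊤ := by
  refine ⟨fun h n => (K.isCompact n).measure_lt_top, fun h => ⟨fun C hC => ?_⟩⟩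
  obtain ⟨n, hn⟩ := K.exists_superset_of_isCompact hC
  exact (measure_mono hn).trans_lt (h n)

theorem measurableSet_isFiniteMeasureOnCompacts :
    MeasurableSet {ω : Sample (X × ℝ) | IsFiniteMeasureOnCompacts (rawMeasure ω)} := by
  let K : CompactExhaustion X := default
  simp_rw [fun ω : Sample (X × ℝ) => isFiniteMeasureOnCompacts_iff (rawMeasure ω) K]
  rw [ofPred_forall]
  refine MeasurableSet.iInter fun n => ?_
  have hK := (K.isCompact n).measurableSet
  simp_rw [← lintegral_indicator_one hK]
  exact measurableSet_lt (measurable_lintegral_rawMeasure (measurable_one.indicator hK))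
    measurable_const

theorem measurable_sampleRadon : Measurable (sampleRadon : Sample (X × ℝ) → RadonMeasure X) := by
  classical
  rw [measurable_radon_iff]
  intro f
  set G := {ω : Sample (X × ℝ) | IsFiniteMeasureOnCompacts (rawMeasure ω)}
  have h : (fun ω => ∫ x, f x ∂(sampleRadon ω).1) = G.indicator fun ω =>
      (∫⁻ x, ENNReal.ofReal (f x) ∂(rawMeasure ω)).toReal -
      (∫⁻ x, ENNReal.ofReal (- f x) ∂(rawMeasure ω)).toReal := by
    funext ω
    by_cases hω : ω ∈ G
    · have hω' : IsFiniteMeasureOnCompacts (rawMeasure ω) := hω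
      change ∫ x, f x ∂(sampleMeasure ω) = _
      have hfi : Integrable (fun x => f x) (rawMeasure ω) :=
        f.continuous.integrable_of_hasCompactSupport f.hasCompactSupport
      rw [indicator_of_mem hω, sampleMeasure_of_finite hω',
        integral_eq_lintegral_pos_part_sub_lintegral_neg_part hfi]
    · have hω' : ¬ IsFiniteMeasureOnCompacts (rawMeasure ω) := hω
      change ∫ x, f x ∂(sampleMeasure ω) = _
      rw [indicator_of_notMem hω, sampleMeasure_of_not_finite hω', integral_zero_measure]
  rw [h]
  have hf := f.continuous.measurable
  exact ((measurable_lintegral_rawMeasure hf.ennreal_ofReal).ennreal_toReal.sub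
    (measurable_lintegral_rawMeasure hf.neg.ennreal_ofReal).ennreal_toReal).indicator
    measurableSet_isFiniteMeasureOnCompacts

theorem sampleRadon_mem_discreteRadon (ω : Sample (X × ℝ)) : sampleRadon ω ∈ discreteRadon X := by
  have hT : (range fun i => (ω.2 i).1).Countable := countable_range _
  refine mem_discreteRadon_of_countable hT ?_
  change sampleMeasure ω _ = 0
  by_cases h : IsFiniteMeasureOnCompacts (rawMeasure ω)
  · rw [sampleMeasure_of_finite h]
    have hm := hT.measurableSet.compl
    have hm' : Measurable fun p : X × ℝ => ENNReal.ofReal p.2 *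
        (range fun i => (ω.2 i).1)ᶜ.indicator 1 p.1 :=
      measurable_snd.ennreal_ofReal.mul ((measurable_one.indicator hm).comp measurable_fst)
    rw [← lintegral_indicator_one hm, lintegral_rawMeasure ω (measurable_one.indicator hm),
      lintegral_pointMeasure ω hm', ENNReal.tsum_eq_zero]
    intro k
    refine Finset.sum_eq_zero fun j _ => ?_
    simp
  · rw [sampleMeasure_of_not_finite h]
    rfl

variable (r : ℕ → ℝ≥0) (ν : ℕ → Measure (X × ℝ)) [∀ k, IsProbabilityMeasure (ν k)]

/-- A measure on `X × ℝ` which is concentrated on `X × (0, ∞)` and integrates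
`(x, s) ↦ min(s, 1)` over `K × (0, ∞)` for compact `K`. -/
structure IsLevy (m : Measure (X × ℝ)) : Prop where
  ae_pos : ∀ᵐ p ∂m, 0 < p.2
  lintegral_lt_top : ∀ K : Set X, IsCompact K →
    ∫⁻ p in K ×ˢ univ, ENNReal.ofReal (min p.2 1) ∂m < ⊤

theorem IsLevy.lintegral_min_lt_top {m : Measure (X × ℝ)} (hm : IsLevy m) {f : X → ℝ} {C : ℝ}
    (hC : ∀ x, |f x| ≤ C) {K : Set X} (hK : IsCompact K) (hf : ∀ x ∉ K, f x = 0) :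
    ∫⁻ p, min ‖p.2 * f p.1‖ₑ 1 ∂m < ⊤ := by
  have hKm : MeasurableSet (K ×ˢ (univ : Set ℝ)) := hK.measurableSet.prod MeasurableSet.univ
  -- Chosen so that `min (s * C) 1 ≤ D * min s 1`.
  set D := max C 1
  have hle : ∀ᵐ p ∂m, min ‖p.2 * f p.1‖ₑ 1 ≤
      ENNReal.ofReal D * (K ×ˢ univ).indicator (fun p => ENNReal.ofReal (min p.2 1)) p := by
    filter_upwards [hm.ae_pos] with p hp
    by_cases hx : p.1 ∈ K
    · rw [indicator_of_mem (by exact ⟨hx, trivial⟩), ← ENNReal.ofReal_mul (by positivity),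
        ← ofReal_norm, ← ENNReal.ofReal_one, ← ENNReal.ofReal_min]
      refine ENNReal.ofReal_le_ofReal ?_
      rw [norm_mul, Real.norm_eq_abs, Real.norm_eq_abs, abs_of_pos hp,
        mul_min_of_nonneg _ _ (by positivity)]
      refine min_le_min ?_ ?_
      · rw [mul_comm]
        exact mul_le_mul_of_nonneg_right ((hC _).trans (le_max_left _ _)) hp.le
      · rw [mul_one]; exact le_max_right _ _
    · simp [hf _ hx]
  refine (lintegral_mono_ae hle).trans_lt ?_
  rw [lintegral_const_mul' _ _ ENNReal.ofReal_ne_top, lintegral_indicator hKm]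
  exact ENNReal.mul_lt_top ENNReal.ofReal_lt_top (hm.lintegral_lt_top K hK)

theorem ae_isFiniteMeasureOnCompacts (hm : IsLevy (intensity r ν)) :
    ∀ᵐ ω ∂(sampleLaw r ν), IsFiniteMeasureOnCompacts (rawMeasure ω) := by
  let K : CompactExhaustion X := default
  simp_rw [fun ω : Sample (X × ℝ) => isFiniteMeasureOnCompacts_iff (rawMeasure ω) K, ae_all_iff]
  intro n
  have hK := (K.isCompact n).measurableSet
  have hmeas : Measurable fun p : X × ℝ => p.2 * (K n).indicator (fun _ => (1 : ℝ)) p.1 :=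
    measurable_snd.mul ((measurable_const.indicator hK).comp measurable_fst)
  have h := hm.lintegral_min_lt_top (f := (K n).indicator fun _ => (1 : ℝ)) (C := 1)
    (fun x => by by_cases hx : x ∈ K n <;> simp [hx]) (K.isCompact n)
    (fun x hx => indicator_of_notMem hx _)
  filter_upwards [ae_integrable_pointMeasure r ν hmeas h] with ω hω
  rw [← lintegral_indicator_one hK, lintegral_rawMeasure ω (measurable_one.indicator hK)]
  refine lt_of_le_of_lt (lintegral_mono fun p => ?_) hω.2
  by_cases hp : p.1 ∈ K n
  · simpa [hp] using Real.ofReal_le_enorm p.2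
  · simp [hp]

theorem integral_rawMeasure {F : Type*} [NormedAddCommGroup F] [NormedSpace ℝ F]
    (ω : Sample (X × ℝ)) (hω : ∀ᵐ p ∂(pointMeasure ω), 0 < p.2)
    {f : X → F} (hf : StronglyMeasurable f) :
    ∫ x, f x ∂(rawMeasure ω) = ∫ p, p.2 • f p.1 ∂(pointMeasure ω) := by
  rw [rawMeasure, integral_map measurable_fst.aemeasurable hf.aestronglyMeasurable,
    integral_withDensity_eq_integral_toReal_smul measurable_snd.ennreal_ofReal
      (Eventually.of_forall fun _ => ENNReal.ofReal_lt_top)]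
  refine integral_congr_ae ?_
  filter_upwards [hω] with p hp
  rw [ENNReal.toReal_ofReal hp.le]

theorem ae_ae_pos (hm : IsLevy (intensity r ν)) :
    ∀ᵐ ω ∂(sampleLaw r ν), ∀ᵐ p ∂(pointMeasure ω), 0 < p.2 := by
  have h := ae_pointMeasure_eq_zero r ν (B := {p : X × ℝ | ¬ 0 < p.2})
    (measurableSet_lt measurable_const measurable_snd).compl (ae_iff.1 hm.ae_pos)
  filter_upwards [h] with ω hω
  exact ae_iff.2 hω

theorem norm_exp_I_sub_one_le (x : ℝ) :
    ‖Complex.exp (Complex.I * (x : ℂ)) - 1‖ₑ ≤ 2 * min ‖x‖ₑ 1 := by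
  rw [mul_min, mul_one]
  refine le_min ?_ ?_
  · calc ‖Complex.exp (Complex.I * (x : ℂ)) - 1‖ₑ ≤ 1 * ‖x‖ₑ := by
          rw [one_mul, ← ofReal_norm, ← ofReal_norm]
          exact ENNReal.ofReal_le_ofReal (Real.norm_exp_I_mul_ofReal_sub_one_le)
      _ ≤ 2 * ‖x‖ₑ := by gcongr; exact one_le_two
  · refine (enorm_sub_le).trans ?_
    rw [← ofReal_norm, mul_comm, Complex.norm_exp_ofReal_mul_I]
    simp [one_add_one_eq_two]

theorem IsLevy.integrable_exp {m : Measure (X × ℝ)} (hm : IsLevy m) {f : X → ℝ}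
    (hfm : Measurable f) {C : ℝ} (hC : ∀ x, |f x| ≤ C) {K : Set X} (hK : IsCompact K)
    (hf : ∀ x ∉ K, f x = 0) :
    Integrable (fun p => Complex.exp (Complex.I * ((p.2 * f p.1 : ℝ) : ℂ)) - 1) m := by
  refine ⟨Measurable.aestronglyMeasurable (by fun_prop), ?_⟩
  refine (lintegral_mono fun p => norm_exp_I_sub_one_le _).trans_lt ?_
  rw [lintegral_const_mul' _ _ (by simp)]
  exact ENNReal.mul_lt_top (by simp) (hm.lintegral_min_lt_top hC hK hf)

/-- The Fourier transform of the random measure, for bounded measurable test functions. -/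
theorem fourier_sampleRadon (hm : IsLevy (intensity r ν)) {f : X → ℝ}
    (hfm : Measurable f) {C : ℝ} (hC : ∀ x, |f x| ≤ C) {K : Set X} (hK : IsCompact K)
    (hf : ∀ x ∉ K, f x = 0) :
    ∫ η : RadonMeasure X, Complex.exp (Complex.I * ((∫ x, f x ∂η.1 : ℝ) : ℂ))
        ∂((sampleLaw r ν).map sampleRadon) =
      Complex.exp (∫ p : X × ℝ, (Complex.exp (Complex.I * ((p.2 * f p.1 : ℝ) : ℂ)) - 1)
        ∂(intensity r ν)) := by
  have hker : Measurable fun η : RadonMeasure X => ∫ x, f x ∂η.1 :=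
    (StronglyMeasurable.integral_kernel_prod_right (κ := radonKernel X) (f := fun _ x => f x)
      (hfm.comp measurable_snd).stronglyMeasurable).measurable
  have hmeas : Measurable fun p : X × ℝ => Complex.I * ((p.2 * f p.1 : ℝ) : ℂ) := by fun_prop
  have hint : ∀ᵐ ω ∂(sampleLaw r ν), Integrable
      (fun p : X × ℝ => Complex.I * ((p.2 * f p.1 : ℝ) : ℂ)) (pointMeasure ω) := by
    refine ae_integrable_pointMeasure r ν hmeas ?_
    refine lt_of_le_of_lt (lintegral_mono fun p => ?_) (hm.lintegral_min_lt_top hC hK hf)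
    rw [enorm_mul, ← ofReal_norm Complex.I, Complex.norm_I, ENNReal.ofReal_one, one_mul,
      ← ofReal_norm, Complex.norm_real, ofReal_norm]
  rw [← (integral_exp_integral_pointMeasure r ν hmeas (hm.integrable_exp hfm hC hK hf) hint).2,
    integral_map measurable_sampleRadon.aemeasurable
      (Measurable.aestronglyMeasurable (by fun_prop))]
  refine integral_congr_ae ?_
  filter_upwards [ae_isFiniteMeasureOnCompacts r ν hm, ae_ae_pos r ν hm] with ω h1 h2
  change Complex.exp (Complex.I * ((∫ x, f x ∂(sampleMeasure ω) : ℝ) : ℂ)) = _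
  rw [sampleMeasure_of_finite h1, integral_rawMeasure ω h2 hfm.stronglyMeasurable,
    integral_const_mul, integral_complex_ofReal]
  rfl

theorem measurable_radon_apply {A : Set X} (hA : MeasurableSet A) :
    Measurable fun η : RadonMeasure X => η.1 A :=
  (Measure.measurable_coe hA).comp measurable_coe_radon

/-- Apply the Fourier formula to `f = ∑ t_i 1_{A_i}`. Disjointness makes `e^{isf} - 1` the sum of
the corresponding terms for each `A_i`, so the joint characteristic function factors. This is why
that formula is needed for discontinuous test functions. -/
theorem isCompletelyRandom_sampleRadon (hm : IsLevy (intensity r ν)) :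
    IsCompletelyRandom ((sampleLaw r ν).map (sampleRadon : Sample (X × ℝ) → RadonMeasure X)) := by
  intro n A hA hdisj
  have hprob : IsProbabilityMeasure ((sampleLaw r ν).map
      (sampleRadon : Sample (X × ℝ) → RadonMeasure X)) :=
    Measure.isProbabilityMeasure_map measurable_sampleRadon.aemeasurable
  set μ := (sampleLaw r ν).map (sampleRadon : Sample (X × ℝ) → RadonMeasure X)
  have hAm : ∀ i, MeasurableSet (A i) := fun i => (hA i).1
  have hfin : ∀ i (η : RadonMeasure X), η.1 (A i) ≠ ⊤ := fun i η =>
    ((measure_mono subset_closure).trans_lt (hA i).2.1.measure_lt_top).ne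
  have hRm : ∀ i, Measurable fun η : RadonMeasure X => η.1.real (A i) := fun i =>
    (measurable_radon_apply (hAm i)).ennreal_toReal
  suffices h : iIndepFun (fun (i : Fin n) (η : RadonMeasure X) => η.1.real (A i)) μ by
    have h2 := h.comp (fun _ => ENNReal.ofReal) fun _ => ENNReal.measurable_ofReal
    convert! h2 using 3 with i η
    exact (ENNReal.ofReal_toReal (hfin i η)).symm
  rw [iIndepFun_iff_charFun_pi fun i => (hRm i).aemeasurable]
  intro t
  -- The full index set gives the joint characteristic function, singletons give the marginals.
  have hf : ∀ S : Finset (Fin n), ∫ η : RadonMeasure X, Complex.exp (Complex.I *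
      ((∑ i ∈ S, t i * η.1.real (A i) : ℝ) : ℂ)) ∂μ = Complex.exp (∑ i ∈ S,
        ∫ p : X × ℝ, (Complex.exp (Complex.I *
          ((p.2 * (A i).indicator (fun _ => t i) p.1 : ℝ) : ℂ)) - 1) ∂(intensity r ν)) := by
    intro S
    have hb : ∀ i x, |(A i).indicator (fun _ => t i) x| ≤ |t i| := fun i x => by
      by_cases hx : x ∈ A i <;> simp [hx]
    have hmi : ∀ i, Measurable ((A i).indicator fun _ => t i) := fun i =>
      measurable_const.indicator (hAm i)
    have hz : ∀ i, ∀ x ∉ closure (A i), (A i).indicator (fun _ => t i) x = 0 := fun i x hx =>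
      indicator_of_notMem (fun h => hx (subset_closure h)) _
    have h1 := fourier_sampleRadon r ν hm (f := fun x => ∑ i ∈ S, (A i).indicator (fun _ => t i) x)
      (Finset.measurable_sum _ fun i _ => hmi i) (C := ∑ i ∈ S, |t i|)
      (fun x => (Finset.abs_sum_le_sum_abs _ _).trans (Finset.sum_le_sum fun i _ => hb i x))
      (K := ⋃ i ∈ S, closure (A i)) (S.isCompact_biUnion fun i _ => (hA i).2.1)
      (fun x hx => Finset.sum_eq_zero fun i hi => hz i x fun h => hx (mem_biUnion hi h))
    have h2 : ∀ η : RadonMeasure X, ∫ x, ∑ i ∈ S, (A i).indicator (fun _ => t i) x ∂η.1 =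
        ∑ i ∈ S, t i * η.1.real (A i) := fun η => by
      have hi : ∀ i, Integrable ((A i).indicator fun _ => t i) η.1 := fun i =>
        (integrable_indicator_iff (hAm i)).2 (integrableOn_const (hfin i η))
      rw [integral_finsetSum _ fun i _ => hi i]
      refine Finset.sum_congr rfl fun i _ => ?_
      rw [integral_indicator_const _ (hAm i), smul_eq_mul, mul_comm]
    simp_rw [h2] at h1
    rw [h1, ← integral_finsetSum _ fun i _ => hm.integrable_exp (hmi i) (hb i) (hA i).2.1 (hz i)]
    congr 1
    refine integral_congr_ae (Eventually.of_forall fun p => ?_)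
    simp only
    by_cases hp : ∃ i ∈ S, p.1 ∈ A i
    · obtain ⟨i, hi, hpi⟩ := hp
      have hne : ∀ j ∈ S, j ≠ i → (A j).indicator (fun _ => t j) p.1 = 0 := fun j _ hj =>
        indicator_of_notMem (fun h => (hdisj hj).le_bot ⟨h, hpi⟩) _
      rw [Finset.sum_eq_single_of_mem i hi hne, Finset.sum_eq_single_of_mem i hi fun j hj hji => by
        rw [hne j hj hji]; simp]
    · push Not at hp
      have hz : ∀ j ∈ S, (A j).indicator (fun _ => t j) p.1 = 0 := fun j hj =>
        indicator_of_notMem (hp j hj) _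
      rw [Finset.sum_eq_zero hz, Finset.sum_eq_zero fun j hj => by rw [hz j hj]; simp]
      simp
  rw [charFun_apply, integral_map (Measurable.aemeasurable (by fun_prop))
    (Continuous.aestronglyMeasurable (by fun_prop))]
  have h1 : ∀ η : RadonMeasure X, Complex.exp
      ((inner ℝ (WithLp.toLp 2 fun i => η.1.real (A i)) t : ℝ) * Complex.I) = Complex.exp (Complex.I *
      ((∑ i, t i * η.1.real (A i) : ℝ) : ℂ)) := fun η => by
    rw [mul_comm, PiLp.inner_apply]
    simp [mul_comm]
  simp_rw [h1]
  rw [hf Finset.univ, Complex.exp_sum]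
  refine Finset.prod_congr rfl fun i _ => ?_
  rw [charFun_apply, integral_map (hRm i).aemeasurable (Continuous.aestronglyMeasurable (by fun_prop))]
  have h2 := hf {i}
  rw [Finset.sum_singleton] at h2
  rw [← h2]
  refine integral_congr_ae (Eventually.of_forall fun η => ?_)
  simp [mul_comm]

theorem hasLevyMeasure_sampleRadon (hm : IsLevy (intensity r ν)) :
    HasLevyMeasure ((sampleLaw r ν).map (sampleRadon : Sample (X × ℝ) → RadonMeasure X))
      (intensity r ν) where
  isProbabilityMeasure := Measure.isProbabilityMeasure_map measurable_sampleRadon.aemeasurable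
  isCompletelyRandom := isCompletelyRandom_sampleRadon r ν hm
  ae_mem_discreteRadon := by
    have : ∀ᵐ ω ∂(sampleLaw r ν), sampleRadon ω ∈ discreteRadon X :=
      Eventually.of_forall sampleRadon_mem_discreteRadon
    exact (ae_map_iff measurable_sampleRadon.aemeasurable measurableSet_discreteRadon).2 this
  fourier f := by
    obtain ⟨C, hC⟩ := f.hasCompactSupport.exists_bound_of_continuous f.continuous
    exact fourier_sampleRadon r ν hm f.continuous.measurable hC f.hasCompactSupport
      fun x hx => image_eq_zero_of_notMem_tsupport hx

end Construction

end CRM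

end

noncomputable section

open Filter Topology
open scoped ENNReal NNReal CompactlySupported

namespace CRM

-- The scale-invariant measure `ds / s`.

section MulHaar

/-- The measure `ds / s` on `(0, ∞)`. -/
def mulHaar : Measure ℝ :=
  (volume.restrict (Ioi (0 : ℝ))).withDensity fun s => ENNReal.ofReal s⁻¹

instance : SFinite mulHaar := by
  unfold mulHaar; infer_instance

theorem ae_mulHaar_pos : ∀ᵐ s ∂mulHaar, 0 < s :=
  (withDensity_absolutelyContinuous _ _).ae_le (ae_restrict_mem measurableSet_Ioi)

theorem lintegral_div {S : Set ℝ} (hS : MeasurableSet S) (hpos : S ⊆ Ioi 0) {h : ℝ → ℝ}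
    (hh : Measurable h) :
    ∫⁻ s in S, ENNReal.ofReal (h s / s) = ∫⁻ s in S, ENNReal.ofReal (h s) ∂mulHaar := by
  rw [mulHaar, restrict_withDensity hS, Measure.restrict_restrict hS,
    inter_eq_left.2 hpos, lintegral_withDensity_eq_lintegral_mul _
      measurable_inv.ennreal_ofReal hh.ennreal_ofReal]
  refine setLIntegral_congr_fun hS fun s hs => ?_
  simp only [Pi.mul_apply]
  rw [← ENNReal.ofReal_mul (inv_nonneg.2 (le_of_lt (hpos hs))), div_eq_inv_mul]

/-- The Jacobian `r` of the dilation cancels against the density `1 / (r s)`. -/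
theorem measurePreserving_mulHaar {r : ℝ} (hr : 0 < r) :
    MeasurePreserving (fun s => r * s) mulHaar mulHaar := by
  refine ⟨measurable_const_mul r, Measure.ext_of_lintegral _ fun g hg => ?_⟩
  have hgr : Measurable fun s => g (r * s) := hg.comp (measurable_const_mul r)
  rw [lintegral_map hg (measurable_const_mul r), mulHaar,
    lintegral_withDensity_eq_lintegral_mul _ measurable_inv.ennreal_ofReal hg,
    lintegral_withDensity_eq_lintegral_mul _ measurable_inv.ennreal_ofReal hgr, ← lintegral_indicator measurableSet_Ioi,
    ← lintegral_indicator measurableSet_Ioi]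
  set G : ℝ → ℝ≥0∞ := (Ioi 0).indicator ((fun s : ℝ => ENNReal.ofReal s⁻¹) * g)
  have hG : Measurable G :=
    (measurable_inv.ennreal_ofReal.mul hg).indicator measurableSet_Ioi
  conv_rhs => rw [← Real.smul_map_volume_mul_left hr.ne', lintegral_smul_measure,
    lintegral_map hG (measurable_const_mul r), abs_of_pos hr, smul_eq_mul,
    ← lintegral_const_mul' _ _ ENNReal.ofReal_ne_top]
  refine lintegral_congr fun s => ?_
  by_cases hs : 0 < s
  · rw [indicator_of_mem (show s ∈ Ioi 0 from hs)]
    simp only [G]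
    rw [indicator_of_mem (show r * s ∈ Ioi 0 from mul_pos hr hs)]
    simp only [Pi.mul_apply]
    rw [← mul_assoc, ← ENNReal.ofReal_mul hr.le, mul_inv, ← mul_assoc, mul_inv_cancel₀ hr.ne',
      one_mul]
  · rw [indicator_of_notMem (show s ∉ Ioi 0 from hs)]
    simp only [G]
    rw [indicator_of_notMem (show r * s ∉ Ioi 0 from fun h => hs (pos_of_mul_pos_right h hr.le)),
      mul_zero]

theorem setLIntegral_comp_mul_le {r : ℝ} (hr : 0 < r) {S T : Set ℝ} (hT : MeasurableSet T)
    (hST : ∀ s ∈ S, r * s ∈ T) {F : ℝ → ℝ≥0∞} (hF : Measurable F) :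
    ∫⁻ s in S, F (r * s) ∂mulHaar ≤ ∫⁻ s in T, F s ∂mulHaar := by
  rw [← (measurePreserving_mulHaar hr).setLIntegral_comp_preimage hT hF]
  exact lintegral_mono_set hST

end MulHaar

-- The scaling condition.

section Scaling

variable {X : Type*} [TopologicalSpace X] [MeasurableSpace X]

/-- By the mean value theorem `|l₁(rs) - l₁(s)| / s` is at most `|r - 1|` times the supremum of the
derivative on `[s/n, sn]`, so the singular factor `1 / s` disappears. The `l₂` terms are estimated
separately, the one at `rs` by invariance of `ds / s`. -/
theorem scalingCondition {σ : Measure X} {l : X → ℝ → ℝ} {ε : ℝ} (hε : 0 < ε)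
    {l₁ l₂ : X → ℝ → ℝ} (hl₂_meas : Measurable (Function.uncurry l₂))
    (hl_add : ∀ x ∈ posSet l, ∀ s ∈ Ioo (0 : ℝ) ε, l x s = l₁ x s + l₂ x s)
    (hl₁_diff : ∀ x ∈ posSet l, DifferentiableOn ℝ (l₁ x) (Ioo (0 : ℝ) ε))
    (hl₁_int : ∀ n : ℕ, 1 ≤ n → ∀ A ∈ boundedBorel (posSet l),
      ∫⁻ x in A, ∫⁻ s in Ioo (0 : ℝ) (ε / n),
        ⨆ u ∈ Icc (s / n) (s * n), ENNReal.ofReal |deriv (l₁ x) u| ∂volume ∂σ < ⊤)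
    (hl₂_int : ∀ A ∈ boundedBorel (posSet l),
      ∫⁻ x in A, ∫⁻ s in Ioo (0 : ℝ) ε, ENNReal.ofReal (|l₂ x s| / s) ∂volume ∂σ < ⊤) :
    ScalingCondition σ l := by
  intro n hn
  have hn0 : (0 : ℝ) < n := by exact_mod_cast hn
  have hn1 : (1 : ℝ) ≤ n := by exact_mod_cast hn
  -- For `s < ε / n` and `r ≤ n`, both `s` and `r * s` stay in `(0, ε)`, where the decomposition of
  -- `l` is valid.
  refine ⟨ε / n, by positivity, fun A hA => ?_⟩
  have hpos : ∀ c : ℝ, Ioo (0 : ℝ) c ⊆ Ioi 0 := fun c s hs => hs.1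
  have hl₂x : ∀ x, Measurable (l₂ x) := fun x => hl₂_meas.comp measurable_prodMk_left
  set S : X → ℝ → ℝ≥0∞ := fun x s => ⨆ u ∈ Icc (s / n) (s * n), ENNReal.ofReal |deriv (l₁ x) u|
  set L : X → ℝ≥0∞ := fun x => ∫⁻ s in Ioo (0 : ℝ) ε, ENNReal.ofReal (|l₂ x s| / s)
  have hLm : Measurable L := by
    refine Measurable.lintegral_prod_right' (f := fun p : X × ℝ => ENNReal.ofReal (|l₂ p.1 p.2| / p.2))
      ?_
    have : Measurable fun p : X × ℝ => l₂ p.1 p.2 := hl₂_meas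
    fun_prop
  have hpt : ∀ x ∈ A, (⨆ r ∈ Icc (1 / (n : ℝ)) (n : ℝ),
      ∫⁻ s in Ioo (0 : ℝ) (ε / n), ENNReal.ofReal (|l x (r * s) - l x s| / s)) ≤
      n * (∫⁻ s in Ioo (0 : ℝ) (ε / n), S x s) + 2 * L x := by
    intro x hx
    have hxY := hA.2.2 hx
    refine iSup₂_le fun r hr => ?_
    have hr0 : 0 < r := lt_of_lt_of_le (by positivity) hr.1
    have hmem : ∀ s ∈ Ioo (0 : ℝ) (ε / n), s ∈ Ioo (0 : ℝ) ε ∧ r * s ∈ Ioo (0 : ℝ) ε := by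
      intro s hs
      have h1 : s * n < ε := (lt_div_iff₀ hn0).1 hs.2
      refine ⟨⟨hs.1, lt_of_le_of_lt (le_mul_of_one_le_right hs.1.le hn1) h1⟩,
        mul_pos hr0 hs.1, lt_of_le_of_lt ?_ h1⟩
      rw [mul_comm]
      exact mul_le_mul_of_nonneg_left hr.2 hs.1.le
    have hmvt : ∀ s ∈ Ioo (0 : ℝ) (ε / n),
        ENNReal.ofReal (|l₁ x (r * s) - l₁ x s| / s) ≤ n * S x s := by
      intro s hs
      obtain ⟨h1, h2⟩ := hmem s hs
      obtain ⟨c, hc, hcd⟩ : ∃ c ∈ Icc (s / n) (s * n),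
          |l₁ x (r * s) - l₁ x s| = |deriv (l₁ x) c| * |r * s - s| := by
        have hs1 : s / n ≤ s := div_le_self hs.1.le hn1
        have hs2 : s ≤ s * n := le_mul_of_one_le_right hs.1.le hn1
        have hs3 : s / n ≤ r * s := by
          rw [div_eq_mul_one_div, mul_comm r]
          exact mul_le_mul_of_nonneg_left hr.1 hs.1.le
        have hs4 : r * s ≤ s * n := by
          rw [mul_comm r]
          exact mul_le_mul_of_nonneg_left hr.2 hs.1.le
        have mvt : ∀ a b, a ∈ Ioo (0 : ℝ) ε → b ∈ Ioo (0 : ℝ) ε → a < b → ∃ c ∈ Ioo a b,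
            |l₁ x b - l₁ x a| = |deriv (l₁ x) c| * |b - a| := by
          intro a b ha hb hab
          have hsub : Icc a b ⊆ Ioo 0 ε := fun u hu =>
            ⟨ha.1.trans_le hu.1, hu.2.trans_lt hb.2⟩
          obtain ⟨c, hc, h⟩ := exists_deriv_eq_slope (l₁ x) hab
            ((hl₁_diff x hxY).continuousOn.mono hsub)
            ((hl₁_diff x hxY).mono (Ioo_subset_Icc_self.trans hsub))
          refine ⟨c, hc, ?_⟩
          rw [h, ← abs_mul, div_mul_cancel₀ _ (sub_pos.2 hab).ne']
        rcases lt_trichotomy (r * s) s with h | h | h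
        · obtain ⟨c, hc, e⟩ := mvt _ _ h2 h1 h
          refine ⟨c, ⟨hs3.trans hc.1.le, hc.2.le.trans hs2⟩, ?_⟩
          rw [abs_sub_comm, e, abs_sub_comm s]
        · exact ⟨s, ⟨hs1, hs2⟩, by simp [h]⟩
        · obtain ⟨c, hc, e⟩ := mvt _ _ h1 h2 h
          exact ⟨c, ⟨hs1.trans hc.1.le, hc.2.le.trans hs4⟩, e⟩
      have hle : |l₁ x (r * s) - l₁ x s| / s ≤ n * |deriv (l₁ x) c| := by
        rw [hcd, div_le_iff₀ hs.1]
        have h3 : |r * s - s| ≤ n * s := by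
          have : r * s - s = (r - 1) * s := by ring
          rw [this, abs_mul, abs_of_pos hs.1]
          refine mul_le_mul_of_nonneg_right (abs_le.2 ⟨?_, ?_⟩) hs.1.le
          · linarith
          · linarith [hr.2]
        calc |deriv (l₁ x) c| * |r * s - s| ≤ |deriv (l₁ x) c| * (n * s) := by gcongr
          _ = _ := by ring
      refine (ENNReal.ofReal_le_ofReal hle).trans ?_
      rw [ENNReal.ofReal_mul hn0.le, ENNReal.ofReal_natCast]
      gcongr
      exact le_iSup₂ (f := fun u _ => ENNReal.ofReal |deriv (l₁ x) u|) c hc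
    have hbound : ∀ s ∈ Ioo (0 : ℝ) (ε / n), ENNReal.ofReal (|l x (r * s) - l x s| / s) ≤
        n * S x s + (ENNReal.ofReal (|l₂ x (r * s)| / s) + ENNReal.ofReal (|l₂ x s| / s)) := by
      intro s hs
      obtain ⟨h1, h2⟩ := hmem s hs
      have hle : |l x (r * s) - l x s| / s ≤
          |l₁ x (r * s) - l₁ x s| / s + (|l₂ x (r * s)| / s + |l₂ x s| / s) := by
        rw [← add_div, ← add_div]
        refine div_le_div_of_nonneg_right ?_ hs.1.le
        rw [hl_add x hxY _ h1, hl_add x hxY _ h2]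
        calc _ = |(l₁ x (r * s) - l₁ x s) + (l₂ x (r * s) - l₂ x s)| := by ring_nf
          _ ≤ _ := (abs_add_le _ _).trans (by gcongr; exact abs_sub _ _)
      refine (ENNReal.ofReal_le_ofReal hle).trans ?_
      have hs0 := hs.1.le
      rw [ENNReal.ofReal_add (by positivity) (by positivity),
        ENNReal.ofReal_add (by positivity) (by positivity)]
      gcongr
      exact hmvt s hs
    have m1 : Measurable fun s => ENNReal.ofReal (|l₂ x (r * s)| / s) := by
      have := (hl₂x x).comp (measurable_const_mul r)
      have h : Measurable fun s => l₂ x (r * s) := this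
      fun_prop
    have m2 : Measurable fun s => ENNReal.ofReal (|l₂ x s| / s) := by
      have := hl₂x x
      fun_prop
    have b1 : ∫⁻ s in Ioo (0 : ℝ) (ε / n), ENNReal.ofReal (|l₂ x (r * s)| / s) ≤ L x := by
      have ha : Measurable fun s => |l₂ x s| := (hl₂x x).abs
      rw [lintegral_div measurableSet_Ioo (hpos _) (h := fun s => |l₂ x (r * s)|)
        (ha.comp (measurable_const_mul r))]
      simp only [L]
      rw [lintegral_div measurableSet_Ioo (hpos _) ha]
      exact setLIntegral_comp_mul_le hr0 measurableSet_Ioo (fun s hs => (hmem s hs).2)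
        ha.ennreal_ofReal
    have b2 : ∫⁻ s in Ioo (0 : ℝ) (ε / n), ENNReal.ofReal (|l₂ x s| / s) ≤ L x :=
      lintegral_mono_set fun s hs => (hmem s hs).1
    calc ∫⁻ s in Ioo (0 : ℝ) (ε / n), ENNReal.ofReal (|l x (r * s) - l x s| / s)
        ≤ ∫⁻ s in Ioo (0 : ℝ) (ε / n), (n * S x s +
          (ENNReal.ofReal (|l₂ x (r * s)| / s) + ENNReal.ofReal (|l₂ x s| / s))) :=
          setLIntegral_mono' measurableSet_Ioo hbound
      _ ≤ _ := by
        have m3 : Measurable fun s =>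
            ENNReal.ofReal (|l₂ x (r * s)| / s) + ENNReal.ofReal (|l₂ x s| / s) := m1.add m2
        -- Only the `l₂` part has to be measurable here, so nothing is required of the uncountable
        -- supremum `S x`.
        rw [lintegral_add_right _ m3, lintegral_add_left m1,
          lintegral_const_mul' _ _ (ENNReal.natCast_ne_top n), two_mul]
        gcongr
  calc _ ≤ ∫⁻ x in A, (n * (∫⁻ s in Ioo (0 : ℝ) (ε / n), S x s) + 2 * L x) ∂σ :=
        setLIntegral_mono' hA.1 hpt
    _ = n * (∫⁻ x in A, ∫⁻ s in Ioo (0 : ℝ) (ε / n), S x s ∂volume ∂σ) + 2 * ∫⁻ x in A, L x ∂σ := by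
        rw [lintegral_add_right _ (hLm.const_mul 2),
          lintegral_const_mul' _ _ (ENNReal.natCast_ne_top n), lintegral_const_mul' _ _ (by simp)]
    _ < ⊤ := ENNReal.add_lt_top.2 ⟨ENNReal.mul_lt_top (ENNReal.natCast_lt_top n) (hl₁_int n hn A hA),
        ENNReal.mul_lt_top (by simp) (hl₂_int A hA)⟩

end Scaling

-- The Lévy measure and integrability of the compensator.

section Levy

variable {X : Type*} [TopologicalSpace X] [PolishSpace X] [LocallyCompactSpace X]
  [MeasurableSpace X] [BorelSpace X] {σ : Measure X} [IsFiniteMeasureOnCompacts σ]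
  {l : X → ℝ → ℝ}

theorem levyMeasure_eq (hl : Measurable (Function.uncurry l)) :
    levyMeasure σ l = (σ.prod mulHaar).withDensity fun p => ENNReal.ofReal (l p.1 p.2) := by
  have h1 : Measurable fun p : X × ℝ => ENNReal.ofReal (l p.1 p.2) := hl.ennreal_ofReal
  have h2 : Measurable fun p : X × ℝ => ENNReal.ofReal p.2⁻¹ :=
    measurable_inv.ennreal_ofReal.comp measurable_snd
  rw [mulHaar, prod_withDensity_right measurable_inv.ennreal_ofReal,
    ← withDensity_mul _ h2 h1, levyMeasure]
  refine withDensity_congr_ae ?_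
  have hpos : ∀ᵐ p ∂(σ.prod (volume.restrict (Ioi (0 : ℝ)))), 0 < p.2 :=
    Measure.quasiMeasurePreserving_snd.ae (ae_restrict_mem measurableSet_Ioi)
  filter_upwards [hpos] with p hp
  simp only [Pi.mul_apply]
  rw [← ENNReal.ofReal_mul (inv_nonneg.2 hp.le), div_eq_inv_mul]

theorem lintegral_levyMeasure (hl : Measurable (Function.uncurry l)) {g : X × ℝ → ℝ≥0∞}
    (hg : Measurable g) : ∫⁻ p, g p ∂(levyMeasure σ l) =
      ∫⁻ x, ∫⁻ s, ENNReal.ofReal (l x s) * g (x, s) ∂mulHaar ∂σ := by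
  have h1 : Measurable fun p : X × ℝ => ENNReal.ofReal (l p.1 p.2) := hl.ennreal_ofReal
  rw [levyMeasure_eq hl, lintegral_withDensity_eq_lintegral_mul _ h1 hg,
    lintegral_prod _ (h1.mul hg).aemeasurable]
  rfl

theorem ae_levyMeasure (hl : Measurable (Function.uncurry l))
    (hl_pos : ∀ x, (∀ s : ℝ, 0 < s → 0 < l x s) ∨ (∀ s : ℝ, 0 < s → l x s = 0)) :
    ∀ᵐ p ∂(levyMeasure σ l), p.1 ∈ posSet l ∧ 0 < p.2 := by
  have h1 : Measurable fun p : X × ℝ => ENNReal.ofReal (l p.1 p.2) := hl.ennreal_ofReal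
  have hpos : ∀ᵐ p ∂(σ.prod mulHaar), 0 < p.2 :=
    Measure.quasiMeasurePreserving_snd.ae ae_mulHaar_pos
  rw [levyMeasure_eq hl, ae_withDensity_iff h1]
  filter_upwards [hpos] with p hp hne
  refine ⟨(hl_pos p.1).resolve_right fun h0 => hne ?_, hp⟩
  simp [h0 p.2 hp]

theorem isCompact_inter_mem_boundedBorel (hY : MeasurableSet (posSet l)) {K : Set X}
    (hK : IsCompact K) : K ∩ posSet l ∈ boundedBorel (posSet l) :=
  ⟨hK.measurableSet.inter hY, hK.closure_of_subset inter_subset_left, inter_subset_right⟩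

theorem measurable_min_mul (hl : Measurable (Function.uncurry l)) :
    Measurable fun x => ∫⁻ s in Ioi (0 : ℝ), ENNReal.ofReal (l x s * min s⁻¹ 1) := by
  refine Measurable.lintegral_prod_right'
    (f := fun p : X × ℝ => ENNReal.ofReal (l p.1 p.2 * min p.2⁻¹ 1)) ?_
  have : Measurable fun p : X × ℝ => l p.1 p.2 := hl
  fun_prop

theorem isLevy_levyMeasure (hl : Measurable (Function.uncurry l))
    (hl_pos : ∀ x, (∀ s : ℝ, 0 < s → 0 < l x s) ∨ (∀ s : ℝ, 0 < s → l x s = 0))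
    (hl_int : ∀ A ∈ boundedBorel (posSet l),
      ∫⁻ x in A, ∫⁻ s in Ioi (0 : ℝ), ENNReal.ofReal (l x s * min s⁻¹ 1) ∂volume ∂σ < ⊤) :
    IsLevy (levyMeasure σ l) where
  ae_pos := (ae_levyMeasure hl hl_pos).mono fun p hp => hp.2
  lintegral_lt_top K hK := by
    have hY := measurableSet_posSet hl hl_pos
    have hA := isCompact_inter_mem_boundedBorel hY hK
    have hKm : MeasurableSet (K ×ˢ (univ : Set ℝ)) := hK.measurableSet.prod MeasurableSet.univ
    refine lt_of_le_of_lt (le_of_eq ?_) (hl_int _ hA)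
    have hmin : Measurable fun p : X × ℝ => ENNReal.ofReal (min p.2 1) := by fun_prop
    rw [← lintegral_indicator hKm, lintegral_levyMeasure hl (hmin.indicator hKm),
      ← lintegral_indicator hA.1]
    refine lintegral_congr fun x => ?_
    have hlx : Measurable (l x) := hl.comp measurable_prodMk_left
    by_cases hx : x ∈ K ∩ posSet l
    · rw [indicator_of_mem hx]
      have e1 : ∀ s ∈ Ioi (0 : ℝ), ENNReal.ofReal (l x s * min s⁻¹ 1) =
          ENNReal.ofReal (l x s * min s 1 / s) := fun s hs => by
        congr 1
        have hs' : (0 : ℝ) < s := hs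
        rw [mul_div_assoc, ← min_div_div_right hs'.le, div_self hs'.ne', one_div, min_comm]
      rw [setLIntegral_congr_fun measurableSet_Ioi e1,
        lintegral_div measurableSet_Ioi Subset.rfl (h := fun s => l x s * min s 1) (by fun_prop)]
      have e2 : mulHaar.restrict (Ioi 0) = mulHaar :=
        Measure.restrict_eq_self_of_ae_mem ae_mulHaar_pos
      rw [e2]
      refine lintegral_congr_ae ?_
      filter_upwards [ae_mulHaar_pos] with s hs
      rw [indicator_of_mem (by exact ⟨hx.1, trivial⟩), ← ENNReal.ofReal_mul (hx.2 s hs).le]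
    · rw [indicator_of_notMem hx, lintegral_eq_zero_iff']
      · filter_upwards [ae_mulHaar_pos] with s hs
        by_cases hxK : x ∈ K
        · have h0 := (hl_pos x).resolve_left fun h => hx ⟨hxK, h⟩
          simp [h0 s hs]
        · rw [indicator_of_notMem (fun h => hxK h.1)]; simp
      · exact (hlx.ennreal_ofReal.mul ((hmin.indicator hKm).comp measurable_prodMk_left)
          ).aemeasurable

/-- Diffuseness of `σ` enters here; through `ae_distinct` it prevents two points of the process from
sharing a position. -/
theorem levyMeasure_fiber (hσ : ∀ x, σ {x} = 0) (x : X) :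
    levyMeasure σ l (Prod.fst ⁻¹' {x}) = 0 := by
  refine withDensity_absolutelyContinuous _ _ ?_
  have : (Prod.fst ⁻¹' {x} : Set (X × ℝ)) = {x} ×ˢ univ := by ext; simp
  rw [this, Measure.prod_prod, hσ, zero_mul]

/-- The relative density `l(x, s / θ(x)) / l(x, s)` of the scaled Lévy measure. -/
def levyRatio (l : X → ℝ → ℝ) (θ : Current X) (p : X × ℝ) : ℝ :=
  l p.1 ((θ p.1)⁻¹ * p.2) / l p.1 p.2

theorem measurable_levyRatio_num (hl : Measurable (Function.uncurry l)) (θ : Current X) :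
    Measurable fun p : X × ℝ => l p.1 ((θ p.1)⁻¹ * p.2) := by
  have h2 : Measurable fun p : X × ℝ => (θ p.1)⁻¹ * p.2 :=
    ((θ.continuous'.measurable.comp measurable_fst).inv).mul measurable_snd
  exact hl.comp (measurable_fst.prodMk h2)

theorem measurable_levyRatio (hl : Measurable (Function.uncurry l)) (θ : Current X) :
    Measurable (levyRatio l θ) := by
  have h4 : Measurable fun p : X × ℝ => l p.1 p.2 := hl
  exact (measurable_levyRatio_num hl θ).div h4

theorem exists_bound_current (θ : Current X) {C : Set X} (hC : IsCompact C) :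
    ∃ n : ℕ, 1 ≤ n ∧ ∀ x ∈ C, (θ x)⁻¹ ∈ Icc (1 / (n : ℝ)) n := by
  obtain ⟨M, hM⟩ := (hC.image θ.continuous').bddAbove
  obtain ⟨M', hM'⟩ := (hC.image (θ.continuous'.inv₀ fun x => (θ.pos' x).ne')).bddAbove
  obtain ⟨n, hn⟩ := exists_nat_ge (max (max M M') 1)
  refine ⟨n, by exact_mod_cast (le_max_right _ _).trans hn, fun x hx => ⟨?_, ?_⟩⟩
  · rw [one_div]
    exact inv_anti₀ (θ.pos' x) ((hM (mem_image_of_mem _ hx)).trans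
      ((le_max_left _ _).trans ((le_max_left _ _).trans hn)))
  · exact (hM' (mem_image_of_mem _ hx)).trans
      ((le_max_right _ _).trans ((le_max_left _ _).trans hn))

/-- Under the scaling condition the change of the Lévy density is integrable. -/
theorem lintegral_compensator_lt_top (hl : Measurable (Function.uncurry l))
    (hl_pos : ∀ x, (∀ s : ℝ, 0 < s → 0 < l x s) ∨ (∀ s : ℝ, 0 < s → l x s = 0))
    (hl_int : ∀ A ∈ boundedBorel (posSet l),
      ∫⁻ x in A, ∫⁻ s in Ioi (0 : ℝ), ENNReal.ofReal (l x s * min s⁻¹ 1) ∂volume ∂σ < ⊤)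
    (hsc : ScalingCondition σ l) (θ : Current X) :
    ∫⁻ x in posSet l, ∫⁻ s in Ioi (0 : ℝ),
      ENNReal.ofReal (|l x ((θ x)⁻¹ * s) - l x s| / s) ∂volume ∂σ < ⊤ := by
  have hY := measurableSet_posSet hl hl_pos
  obtain ⟨C, hC, hθC⟩ := θ.eq_one'
  obtain ⟨n, hn, hθn⟩ := exists_bound_current θ hC
  have hn0 : (0 : ℝ) < n := by exact_mod_cast hn
  have hn1 : (1 : ℝ) ≤ n := by exact_mod_cast hn
  obtain ⟨ε, hε, hsc⟩ := hsc n hn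
  have hA := isCompact_inter_mem_boundedBorel hY hC
  set A := C ∩ posSet l
  set J : X → ℝ≥0∞ := fun x => ∫⁻ s in Ioi (0 : ℝ), ENNReal.ofReal (l x s * min s⁻¹ 1)
  -- On the tail `s ≥ ε` the scaled argument `θ⁻¹(x) s` is still at least `ε / n`, so both terms of
  -- the difference can be bounded by integrals over `[δ, ∞)`.
  set δ := ε / n
  have hδ : 0 < δ := by positivity
  have hδε : δ ≤ ε := div_le_self hε.le hn1
  -- Chosen so that `s⁻¹ ≤ c * min s⁻¹ 1` for `s ≥ δ`.
  set c : ℝ := max 1 δ⁻¹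
  have hc0 : 0 < c := lt_of_lt_of_le one_pos (le_max_left _ _)
  have htail : ∀ x ∈ posSet l, ∫⁻ s in Ici δ, ENNReal.ofReal (l x s) ∂mulHaar ≤
      ENNReal.ofReal c * J x := by
    intro x hx
    have hlx : Measurable (l x) := hl.comp measurable_prodMk_left
    have hsub : Ici δ ⊆ Ioi (0 : ℝ) := fun s hs => hδ.trans_le hs
    rw [← lintegral_div measurableSet_Ici hsub hlx]
    calc ∫⁻ s in Ici δ, ENNReal.ofReal (l x s / s)
        ≤ ∫⁻ s in Ici δ, ENNReal.ofReal c * ENNReal.ofReal (l x s * min s⁻¹ 1) := by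
          refine setLIntegral_mono' measurableSet_Ici fun s hs => ?_
          have hs0 : 0 < s := hsub hs
          rw [← ENNReal.ofReal_mul hc0.le]
          refine ENNReal.ofReal_le_ofReal ?_
          rw [div_eq_mul_inv, mul_left_comm]
          refine mul_le_mul_of_nonneg_left ?_ (hx s hs0).le
          rw [mul_min_of_nonneg _ _ hc0.le]
          refine le_min (le_mul_of_one_le_left (inv_nonneg.2 hs0.le) (le_max_left _ _)) ?_
          rw [mul_one]
          exact (inv_anti₀ hδ hs).trans (le_max_right _ _)
      _ ≤ _ := by
          rw [lintegral_const_mul' _ _ ENNReal.ofReal_ne_top]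
          gcongr
          exact lintegral_mono_set hsub
  have hpt : ∀ x ∈ A, ∫⁻ s in Ioi (0 : ℝ), ENNReal.ofReal (|l x ((θ x)⁻¹ * s) - l x s| / s) ≤
      (⨆ r ∈ Icc (1 / (n : ℝ)) (n : ℝ),
        ∫⁻ s in Ioo (0 : ℝ) ε, ENNReal.ofReal (|l x (r * s) - l x s| / s)) +
      2 * (ENNReal.ofReal c * J x) := by
    intro x hx
    have hlx : Measurable (l x) := hl.comp measurable_prodMk_left
    have hr := hθn x hx.1
    set r := (θ x)⁻¹
    have hr0 : 0 < r := inv_pos.2 (θ.pos' x)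
    have hlr : Measurable fun s => l x (r * s) := hlx.comp (measurable_const_mul r)
    have hsplit : Ioi (0 : ℝ) = Ioo 0 ε ∪ Ici ε := (Ioo_union_Ici_eq_Ioi hε).symm
    rw [hsplit]
    refine (lintegral_union_le _ _ _).trans (add_le_add ?_ ?_)
    · exact le_iSup₂ (f := fun r _ => ∫⁻ s in Ioo (0 : ℝ) ε,
        ENNReal.ofReal (|l x (r * s) - l x s| / s)) r hr
    · rw [lintegral_div measurableSet_Ici (fun s hs => hε.trans_le hs)
        (h := fun s => |l x (r * s) - l x s|) (hlr.sub hlx).abs]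
      calc ∫⁻ s in Ici ε, ENNReal.ofReal |l x (r * s) - l x s| ∂mulHaar
          ≤ ∫⁻ s in Ici ε, (ENNReal.ofReal (l x (r * s)) + ENNReal.ofReal (l x s)) ∂mulHaar := by
            refine setLIntegral_mono' measurableSet_Ici fun s hs => ?_
            have hs0 : 0 < s := hε.trans_le hs
            have p1 := (hx.2 s hs0).le
            have p2 := (hx.2 (r * s) (mul_pos hr0 hs0)).le
            rw [← ENNReal.ofReal_add p2 p1]
            refine ENNReal.ofReal_le_ofReal ((abs_sub _ _).trans ?_)
            rw [abs_of_nonneg p1, abs_of_nonneg p2]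
        _ = ∫⁻ s in Ici ε, ENNReal.ofReal (l x (r * s)) ∂mulHaar +
            ∫⁻ s in Ici ε, ENNReal.ofReal (l x s) ∂mulHaar :=
            lintegral_add_left hlr.ennreal_ofReal _
        _ ≤ _ := by
            rw [two_mul]
            refine add_le_add ?_ ?_
            · refine le_trans (setLIntegral_comp_mul_le hr0 (measurableSet_Ici (a := δ)) ?_
                hlx.ennreal_ofReal) (htail x hx.2)
              intro s hs
              have hs' : ε ≤ s := hs
              have : δ = 1 / (n : ℝ) * ε := by simp only [δ]; ring
              rw [mem_Ici, this]
              exact mul_le_mul hr.1 hs' hε.le hr0.le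
            · exact (lintegral_mono_set (Ici_subset_Ici.2 hδε)).trans (htail x hx.2)
  -- Outside the compact set `C` the current is `1` and nothing changes.
  have hzero : ∀ x ∈ posSet l \ A,
      ∫⁻ s in Ioi (0 : ℝ), ENNReal.ofReal (|l x ((θ x)⁻¹ * s) - l x s| / s) = 0 := by
    intro x hx
    have : θ x = 1 := hθC x fun h => hx.2 ⟨h, hx.1⟩
    simp [this]
  have hYA : posSet l = A ∪ posSet l \ A := (union_sdiff_cancel inter_subset_right).symm
  rw [hYA]
  refine (lintegral_union_le _ _ _).trans_lt ?_
  rw [setLIntegral_congr_fun (hY.diff hA.1) hzero, lintegral_zero, add_zero]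
  refine (setLIntegral_mono' hA.1 hpt).trans_lt ?_
  have hJm : Measurable J := measurable_min_mul hl
  rw [lintegral_add_right _ ((hJm.const_mul _).const_mul _), lintegral_const_mul' _ _ (by simp),
    lintegral_const_mul' _ _ ENNReal.ofReal_ne_top]
  exact ENNReal.add_lt_top.2 ⟨hsc A hA, ENNReal.mul_lt_top (by simp)
    (ENNReal.mul_lt_top ENNReal.ofReal_lt_top (hl_int A hA))⟩

end Levy

end CRM

end

noncomputable section

open Filter Topology
open scoped ENNReal NNReal CompactlySupported

namespace CRM

open PoissonRandom

-- The ratio of the scaled and the original Lévy measure.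

section Ratio

variable {X : Type*} [TopologicalSpace X] [PolishSpace X] [LocallyCompactSpace X]
  [MeasurableSpace X] [BorelSpace X] {σ : Measure X} [IsFiniteMeasureOnCompacts σ]
  {l : X → ℝ → ℝ}

theorem levyRatio_pos (θ : Current X) {p : X × ℝ} (hp : p.1 ∈ posSet l ∧ 0 < p.2) :
    0 < levyRatio l θ p :=
  div_pos (hp.1 _ (mul_pos (inv_pos.2 (θ.pos' _)) hp.2)) (hp.1 _ hp.2)

/-- Multiplying `|ρ - 1|` by the density `l / s` of the Lévy measure gives `|l(x, θ⁻¹ s) - l(x, s)|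
/ s`. -/
theorem integrable_levyRatio_sub_one (hl : Measurable (Function.uncurry l))
    (hl_pos : ∀ x, (∀ s : ℝ, 0 < s → 0 < l x s) ∨ (∀ s : ℝ, 0 < s → l x s = 0)) (θ : Current X)
    (hfin : ∫⁻ x in posSet l, ∫⁻ s in Ioi (0 : ℝ),
      ENNReal.ofReal (|l x ((θ x)⁻¹ * s) - l x s| / s) ∂volume ∂σ < ⊤) :
    Integrable (fun p => levyRatio l θ p - 1) (levyMeasure σ l) := by
  have hY := measurableSet_posSet hl hl_pos
  have hm := (measurable_levyRatio hl θ).sub_const 1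
  refine ⟨hm.aestronglyMeasurable, ?_⟩
  rw [HasFiniteIntegral, lintegral_levyMeasure hl hm.enorm]
  refine lt_of_le_of_lt ?_ hfin
  rw [← lintegral_indicator hY]
  refine lintegral_mono fun x => ?_
  have hlx : Measurable (l x) := hl.comp measurable_prodMk_left
  by_cases hx : x ∈ posSet l
  · rw [indicator_of_mem hx, lintegral_div measurableSet_Ioi Subset.rfl
      (h := fun s => |l x ((θ x)⁻¹ * s) - l x s|)
      ((hlx.comp (measurable_const_mul _)).sub hlx).abs,
      Measure.restrict_eq_self_of_ae_mem (s := Ioi 0) ae_mulHaar_pos]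
    refine lintegral_mono_ae ?_
    filter_upwards [ae_mulHaar_pos] with s hs
    have h0 := hx s hs
    rw [← ofReal_norm, ← ENNReal.ofReal_mul h0.le, Real.norm_eq_abs]
    refine ENNReal.ofReal_le_ofReal (le_of_eq ?_)
    nth_rewrite 1 [← abs_of_pos h0]
    rw [← abs_mul, levyRatio]
    congr 1
    field_simp
  · rw [indicator_of_notMem hx]
    refine le_of_eq ((lintegral_eq_zero_iff' ?_).2 ?_)
    · exact (hlx.ennreal_ofReal.mul (hm.enorm.comp measurable_prodMk_left)).aemeasurable
    · filter_upwards [ae_mulHaar_pos] with s hs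
      have h0 := (hl_pos x).resolve_left hx
      simp [h0 s hs]

theorem integrable_compensator (hl : Measurable (Function.uncurry l)) (θ : Current X)
    (hfin : ∫⁻ x in posSet l, ∫⁻ s in Ioi (0 : ℝ),
      ENNReal.ofReal (|l x ((θ x)⁻¹ * s) - l x s| / s) ∂volume ∂σ < ⊤) :
    Integrable (fun p : X × ℝ => compensator l θ p.1 p.2)
      ((σ.restrict (posSet l)).prod (volume.restrict (Ioi (0 : ℝ)))) := by
  have h1 : Measurable fun p : X × ℝ => l p.1 p.2 := hl
  have hm : Measurable fun p : X × ℝ => compensator l θ p.1 p.2 :=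
    (h1.sub (measurable_levyRatio_num hl θ)).div measurable_snd
  refine ⟨hm.aestronglyMeasurable, ?_⟩
  rw [HasFiniteIntegral, lintegral_prod _ hm.enorm.aemeasurable]
  refine lt_of_le_of_lt (lintegral_mono fun x => ?_) hfin
  refine setLIntegral_mono' measurableSet_Ioi fun s hs => ?_
  have hs' : (0 : ℝ) < s := hs
  rw [compensator, ← ofReal_norm, norm_div, Real.norm_eq_abs, Real.norm_eq_abs, abs_of_pos hs',
    abs_sub_comm]

theorem integral_compensator (hl : Measurable (Function.uncurry l))
    (hl_pos : ∀ x, (∀ s : ℝ, 0 < s → 0 < l x s) ∨ (∀ s : ℝ, 0 < s → l x s = 0)) (θ : Current X)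
    (hint : Integrable (fun p : X × ℝ => compensator l θ p.1 p.2)
      ((σ.restrict (posSet l)).prod (volume.restrict (Ioi (0 : ℝ))))) :
    ∫ x in posSet l, ∫ s in Ioi (0 : ℝ), compensator l θ x s ∂volume ∂σ =
      ∫ p, (1 - levyRatio l θ p) ∂(levyMeasure σ l) := by
  have hY := measurableSet_posSet hl hl_pos
  have h1 : Measurable fun p : X × ℝ => l p.1 p.2 := hl
  have h2 : Measurable fun p : X × ℝ => ENNReal.ofReal (l p.1 p.2 / p.2) :=
    (h1.div measurable_snd).ennreal_ofReal
  rw [← integral_prod _ hint, levyMeasure, integral_withDensity_eq_integral_toReal_smul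
    h2 (Eventually.of_forall fun _ => ENNReal.ofReal_lt_top)]
  have e : (σ.restrict (posSet l)).prod (volume.restrict (Ioi (0 : ℝ))) =
      (σ.prod (volume.restrict (Ioi (0 : ℝ)))).restrict (posSet l ×ˢ univ) := by
    rw [← Measure.prod_restrict, Measure.restrict_univ]
  rw [e, ← integral_indicator (hY.prod MeasurableSet.univ)]
  have hpos : ∀ᵐ p ∂(σ.prod (volume.restrict (Ioi (0 : ℝ)))), 0 < p.2 :=
    Measure.quasiMeasurePreserving_snd.ae (ae_restrict_mem measurableSet_Ioi)
  refine integral_congr_ae ?_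
  filter_upwards [hpos] with p hp
  by_cases hx : p.1 ∈ posSet l
  · have h0 := hx p.2 hp
    rw [indicator_of_mem (by exact ⟨hx, trivial⟩), ENNReal.toReal_ofReal (div_pos h0 hp).le,
      levyRatio, compensator, smul_eq_mul]
    field_simp
  · rw [indicator_of_notMem (fun h => hx h.1), (hl_pos p.1).resolve_left hx p.2 hp]
    simp

/-- Near `1` the logarithm is Lipschitz; farther away `|ρ - 1| ≥ 1/2` and the truncation at `1`
suffices. Hence integrability of `ρ - 1` implies almost sure summability of `log ρ` over the points.
-/
theorem min_abs_log_le {ρ : ℝ} (hρ : 0 < ρ) : min |Real.log ρ| 1 ≤ 2 * |ρ - 1| := by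
  by_cases h : |ρ - 1| < 1 / 2
  · refine (min_le_left _ _).trans ?_
    have h' := abs_lt.1 h
    have h1 := Real.log_le_sub_one_of_pos hρ
    have h2 := Real.log_le_sub_one_of_pos (inv_pos.2 hρ)
    rw [Real.log_inv] at h2
    have h3 : ρ⁻¹ - 1 ≤ 2 * |ρ - 1| := by
      have : ρ⁻¹ - 1 = (1 - ρ) / ρ := by field_simp
      rw [this, div_le_iff₀ hρ]
      have h4 : 1 - ρ ≤ |ρ - 1| := by rw [abs_sub_comm]; exact le_abs_self _
      nlinarith [abs_nonneg (ρ - 1)]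
    exact abs_le.2 ⟨by linarith, by linarith [le_abs_self (ρ - 1), abs_nonneg (ρ - 1)]⟩
  · refine (min_le_right _ _).trans ?_
    linarith [not_lt.1 h]

theorem lintegral_min_log_levyRatio_lt_top (hl : Measurable (Function.uncurry l))
    (hl_pos : ∀ x, (∀ s : ℝ, 0 < s → 0 < l x s) ∨ (∀ s : ℝ, 0 < s → l x s = 0)) (θ : Current X)
    (hint : Integrable (fun p => levyRatio l θ p - 1) (levyMeasure σ l)) :
    ∫⁻ p, min ‖Real.log (levyRatio l θ p)‖ₑ 1 ∂(levyMeasure σ l) < ⊤ := by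
  have hle : ∀ᵐ p ∂(levyMeasure σ l), min ‖Real.log (levyRatio l θ p)‖ₑ 1 ≤
      2 * ‖levyRatio l θ p - 1‖ₑ := by
    filter_upwards [ae_levyMeasure hl hl_pos] with p hp
    have h := min_abs_log_le (levyRatio_pos θ hp)
    rw [← ofReal_norm, ← ofReal_norm, ← ENNReal.ofReal_one, ← ENNReal.ofReal_min,
      ← ENNReal.ofReal_ofNat 2, ← ENNReal.ofReal_mul zero_le_two]
    exact ENNReal.ofReal_le_ofReal h
  refine (lintegral_mono_ae hle).trans_lt ?_
  rw [lintegral_const_mul' _ _ (by simp)]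
  exact ENNReal.mul_lt_top (by simp) hint.2

/-- Scaling the weights by `θ` multiplies the Lévy measure by `levyRatio l θ`. -/
theorem map_levyMeasure (hl : Measurable (Function.uncurry l))
    (hl_pos : ∀ x, (∀ s : ℝ, 0 < s → 0 < l x s) ∨ (∀ s : ℝ, 0 < s → l x s = 0)) (θ : Current X) :
    (levyMeasure σ l).map (fun p : X × ℝ => (p.1, θ p.1 * p.2)) =
      (levyMeasure σ l).withDensity fun p => ENNReal.ofReal (levyRatio l θ p) := by
  have hθ : Measurable fun p : X × ℝ => θ p.1 * p.2 :=
    (θ.continuous'.measurable.comp measurable_fst).mul measurable_snd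
  have hT : MeasurePreserving (fun p : X × ℝ => (p.1, θ p.1 * p.2)) (σ.prod mulHaar)
      (σ.prod mulHaar) :=
    (MeasurePreserving.id σ).skew_product (g := fun x s => θ x * s) hθ
      (Eventually.of_forall fun x => (measurePreserving_mulHaar (θ.pos' x)).map_eq)
  have h1 : Measurable fun p : X × ℝ => ENNReal.ofReal (l p.1 p.2) := hl.ennreal_ofReal
  have h2 := (measurable_levyRatio_num hl θ).ennreal_ofReal
  have h3 := (measurable_levyRatio hl θ).ennreal_ofReal
  refine Measure.ext_of_lintegral _ fun g hg => ?_
  have hgT : Measurable fun p : X × ℝ => g (p.1, θ p.1 * p.2) := hg.comp hT.measurable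
  rw [lintegral_map hg hT.measurable, lintegral_withDensity_eq_lintegral_mul _ h3 hg,
    levyMeasure_eq hl, lintegral_withDensity_eq_lintegral_mul _ h1 hgT,
    lintegral_withDensity_eq_lintegral_mul _ h1 (h3.mul hg)]
  -- Write the density at the original point as a function of the scaled point, so that invariance
  -- of `σ ⊗ ds / s` applies.
  have e1 : ∀ p : X × ℝ, ((fun p : X × ℝ => ENNReal.ofReal (l p.1 p.2)) *
      fun p : X × ℝ => g (p.1, θ p.1 * p.2)) p = (fun q : X × ℝ =>
        ENNReal.ofReal (l q.1 ((θ q.1)⁻¹ * q.2)) * g q) (p.1, θ p.1 * p.2) := fun p => by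
    simp only [Pi.mul_apply]
    rw [inv_mul_cancel_left₀ (θ.pos' p.1).ne']
  have h4 : Measurable fun q : X × ℝ =>
      ENNReal.ofReal (l q.1 ((θ q.1)⁻¹ * q.2)) * g q := h2.mul hg
  refine (lintegral_congr e1).trans ((hT.lintegral_comp h4).trans ?_)
  have hpos : ∀ᵐ p ∂(σ.prod mulHaar), 0 < p.2 :=
    Measure.quasiMeasurePreserving_snd.ae ae_mulHaar_pos
  refine lintegral_congr_ae ?_
  filter_upwards [hpos] with p hp
  simp only [Pi.mul_apply]
  rw [← mul_assoc]
  congr 1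
  rcases hl_pos p.1 with h | h
  · have h0 := h p.2 hp
    rw [← ENNReal.ofReal_mul h0.le, levyRatio, mul_div_cancel₀ _ h0.ne']
  · rw [h _ hp, h _ (mul_pos (inv_pos.2 (θ.pos' p.1)) hp)]
    simp

theorem integral_comp_scale_levyMeasure (hl : Measurable (Function.uncurry l))
    (hl_pos : ∀ x, (∀ s : ℝ, 0 < s → 0 < l x s) ∨ (∀ s : ℝ, 0 < s → l x s = 0)) (θ : Current X)
    {G : X × ℝ → ℂ} (hG : Measurable G) :
    ∫ p, G (p.1, θ p.1 * p.2) ∂(levyMeasure σ l) =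
      ∫ p, (levyRatio l θ p : ℂ) * G p ∂(levyMeasure σ l) := by
  have hθ : Measurable fun p : X × ℝ => (p.1, θ p.1 * p.2) :=
    measurable_fst.prodMk ((θ.continuous'.measurable.comp measurable_fst).mul measurable_snd)
  rw [← integral_map hθ.aemeasurable hG.aestronglyMeasurable, map_levyMeasure hl hl_pos θ,
    integral_withDensity_eq_integral_toReal_smul (measurable_levyRatio hl θ).ennreal_ofReal
      (Eventually.of_forall fun _ => ENNReal.ofReal_lt_top)]
  refine integral_congr_ae ?_
  filter_upwards [ae_levyMeasure hl hl_pos] with p hp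
  rw [ENNReal.toReal_ofReal (levyRatio_pos θ hp).le, Complex.real_smul]

end Ratio

-- Recovering the points of the process from the atoms.

section Atoms

variable {X : Type*} [TopologicalSpace X] [PolishSpace X] [LocallyCompactSpace X]
  [MeasurableSpace X] [BorelSpace X]

theorem _root_.PoissonRandom.ae_pointMeasure_iff {E : Type*} [MeasurableSpace E] (ω : Sample E)
    {P : E → Prop} (hP : MeasurableSet {p | P p}) :
    (∀ᵐ p ∂(pointMeasure ω), P p) ↔ ∀ i : (_ : ℕ) × ℕ, i.2 < ω.1 i.1 → P (ω.2 i) := by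
  have hc : MeasurableSet {p | ¬ P p} := hP.compl
  rw [ae_iff, ← lintegral_indicator_one hc, lintegral_pointMeasure ω (measurable_one.indicator hc),
    ENNReal.tsum_eq_zero]
  simp only [Finset.sum_eq_zero_iff, Finset.mem_range, indicator_apply_eq_zero, mem_ofPred_eq,
    Pi.one_apply, one_ne_zero, imp_false, not_not]
  exact ⟨fun h i => h i.1 i.2, fun h k j => h ⟨k, j⟩⟩

/-- With distinct positions, only the point `i` itself contributes to the mass at its position. -/
theorem rawMeasure_singleton {ω : Sample (X × ℝ)}
    (hd : ∀ i i' : (_ : ℕ) × ℕ, i ≠ i' → i.2 < ω.1 i.1 → (ω.2 i).1 ≠ (ω.2 i').1)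
    {i : (_ : ℕ) × ℕ} (hi : i.2 < ω.1 i.1) :
    rawMeasure ω {(ω.2 i).1} = ENNReal.ofReal (ω.2 i).2 := by
  have hs := measurableSet_singleton (ω.2 i).1
  have hm : Measurable fun p : X × ℝ => ENNReal.ofReal p.2 *
      ({(ω.2 i).1} : Set X).indicator (1 : X → ℝ≥0∞) p.1 :=
    measurable_snd.ennreal_ofReal.mul ((measurable_one.indicator hs).comp measurable_fst)
  rw [← lintegral_indicator_one hs, lintegral_rawMeasure ω (measurable_one.indicator hs),
    lintegral_pointMeasure ω hm, tsum_eq_single i.1, Finset.sum_eq_single_of_mem i.2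
      (Finset.mem_range.2 hi)]
  · simp
  · intro j _ hj
    have : (ω.2 ⟨i.1, j⟩).1 ≠ (ω.2 i).1 := (hd i ⟨i.1, j⟩ (fun h => hj (by rw [h])) hi).symm
    simp [this]
  · intro k hk
    refine Finset.sum_eq_zero fun j _ => ?_
    have : (ω.2 ⟨k, j⟩).1 ≠ (ω.2 i).1 := (hd i ⟨k, j⟩ (fun h => hk (by rw [h])) hi).symm
    simp [this]

theorem integrable_rawMeasure {F : Type*} [NormedAddCommGroup F] [NormedSpace ℝ F]
    (ω : Sample (X × ℝ)) (hω : ∀ᵐ p ∂(pointMeasure ω), 0 < p.2)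
    {f : X → F} (hf : StronglyMeasurable f)
    (hint : Integrable (fun p : X × ℝ => p.2 • f p.1) (pointMeasure ω)) :
    Integrable f (rawMeasure ω) := by
  refine ⟨hf.aestronglyMeasurable, ?_⟩
  rw [HasFiniteIntegral, lintegral_rawMeasure ω hf.enorm]
  refine lt_of_le_of_lt (lintegral_mono_ae ?_) hint.2
  filter_upwards [hω] with p hp
  rw [enorm_smul, ← ofReal_norm p.2, Real.norm_of_nonneg hp.le]

variable {σ : Measure X} [IsFiniteMeasureOnCompacts σ] {l : X → ℝ → ℝ}
  (r : ℕ → ℝ≥0) (ν : ℕ → Measure (X × ℝ)) [∀ k, IsProbabilityMeasure (ν k)]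

/-- Almost surely the weights of the atoms of `sampleRadon` are the second coordinates of the
points. -/
theorem ae_ae_sampleRadon_singleton (hm : IsLevy (intensity r ν))
    (h0 : ∀ x, intensity r ν (Prod.fst ⁻¹' {x}) = 0) :
    ∀ᵐ ω ∂(sampleLaw r ν), ∀ᵐ p ∂(pointMeasure ω), (sampleRadon ω).1.real {p.1} = p.2 := by
  filter_upwards [ae_isFiniteMeasureOnCompacts r ν hm, ae_ae_pos r ν hm,
    ae_distinct r ν measurable_fst h0] with ω h1 h2 h3
  have hpos := (ae_pointMeasure_iff ω (measurableSet_lt measurable_const measurable_snd)).1 h2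
  have hmeas : Measurable fun p : X × ℝ => (sampleRadon ω).1.real {p.1} :=
    measurable_radon_singleton.comp (measurable_const.prodMk measurable_fst)
  rw [ae_pointMeasure_iff ω (measurableSet_eq_fun hmeas measurable_snd)]
  intro i hi
  change (sampleMeasure ω).real _ = _
  rw [sampleMeasure_of_finite h1, measureReal_def, rawMeasure_singleton h3 hi,
    ENNReal.toReal_ofReal (hpos i hi).le]

/-- Integration against `η` weights each point by `s`, which cancels the factor `s_x⁻¹` in
`logRatio` and leaves `log ρ` at each point. -/
theorem ae_integral_logRatio (hl : Measurable (Function.uncurry l))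
    (hl_pos : ∀ x, (∀ s : ℝ, 0 < s → 0 < l x s) ∨ (∀ s : ℝ, 0 < s → l x s = 0))
    (hm : IsLevy (intensity r ν)) (hrν : intensity r ν = levyMeasure σ l)
    (h0 : ∀ x, intensity r ν (Prod.fst ⁻¹' {x}) = 0) (θ : Current X)
    (hint : Integrable (fun p => levyRatio l θ p - 1) (levyMeasure σ l)) :
    ∀ᵐ ω ∂(sampleLaw r ν), IntegrableOn (logRatio l θ (sampleRadon ω)) (posSet l) (sampleRadon ω).1 ∧
      ∫ x in posSet l, logRatio l θ (sampleRadon ω) x ∂(sampleRadon ω).1 =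
        ∫ p, Real.log (levyRatio l θ p) ∂(pointMeasure ω) := by
  have hY := measurableSet_posSet hl hl_pos
  have hYN : ∀ᵐ ω ∂(sampleLaw r ν), ∀ᵐ p ∂(pointMeasure ω), p.1 ∈ posSet l := by
    have hnull : intensity r ν {p : X × ℝ | ¬ p.1 ∈ posSet l} = 0 := by
      rw [hrν]
      exact ae_iff.1 ((ae_levyMeasure hl hl_pos).mono fun p hp => hp.1)
    filter_upwards [ae_pointMeasure_eq_zero r ν (measurable_fst hY.compl) hnull] with ω hω
    exact ae_iff.2 hω
  have hlog : ∀ᵐ ω ∂(sampleLaw r ν),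
      Integrable (fun p => Real.log (levyRatio l θ p)) (pointMeasure ω) := by
    refine ae_integrable_pointMeasure r ν (Real.measurable_log.comp (measurable_levyRatio hl θ)) ?_
    rw [hrν]
    exact lintegral_min_log_levyRatio_lt_top hl hl_pos θ hint
  filter_upwards [ae_isFiniteMeasureOnCompacts r ν hm, ae_ae_pos r ν hm,
    ae_ae_sampleRadon_singleton r ν hm h0, hYN, hlog] with ω h1 h2 h3 h4 h5
  have hmeas : Measurable (logRatio l θ (sampleRadon ω)) :=
    (measurable_logRatio hl θ).comp measurable_prodMk_left
  have hsm := (hmeas.indicator hY).stronglyMeasurable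
  have heq : (fun p : X × ℝ => p.2 • (posSet l).indicator (logRatio l θ (sampleRadon ω)) p.1)
      =ᵐ[pointMeasure ω] fun p => Real.log (levyRatio l θ p) := by
    filter_upwards [h2, h3, h4] with p p2 p3 p4
    rw [indicator_of_mem p4, logRatio, p3, levyRatio, smul_eq_mul]
    field_simp
  have hcoe : (sampleRadon ω).1 = rawMeasure ω := sampleMeasure_of_finite h1
  rw [← integrable_indicator_iff hY, ← integral_indicator hY, hcoe]
  exact ⟨integrable_rawMeasure ω h2 hsm (h5.congr heq.symm),
    (integral_rawMeasure ω h2 hsm).trans (integral_congr_ae heq)⟩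

end Atoms

-- The density formula for the Poisson model.

section Density

variable {X : Type*} [TopologicalSpace X] [PolishSpace X] [LocallyCompactSpace X]
  [MeasurableSpace X] [BorelSpace X] {σ : Measure X} [IsFiniteMeasureOnCompacts σ] {l : X → ℝ → ℝ}
  (r : ℕ → ℝ≥0) (ν : ℕ → Measure (X × ℝ)) [∀ k, IsProbabilityMeasure (ν k)]

/-- The weighted Fourier transform, without the compensating factor. -/
theorem integral_exp_log_levyRatio (hl : Measurable (Function.uncurry l))
    (hl_pos : ∀ x, (∀ s : ℝ, 0 < s → 0 < l x s) ∨ (∀ s : ℝ, 0 < s → l x s = 0))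
    (hm : IsLevy (intensity r ν)) (hrν : intensity r ν = levyMeasure σ l) (θ : Current X)
    (hint : Integrable (fun p => levyRatio l θ p - 1) (levyMeasure σ l)) (f : C_c(X, ℝ)) :
    Integrable (fun ω => Complex.exp (((∫ p, Real.log (levyRatio l θ p) ∂(pointMeasure ω) : ℝ) : ℂ) +
      Complex.I * ((∫ p, p.2 * f p.1 ∂(pointMeasure ω) : ℝ) : ℂ))) (sampleLaw r ν) ∧
    ∫ ω, Complex.exp (((∫ p, Real.log (levyRatio l θ p) ∂(pointMeasure ω) : ℝ) : ℂ) +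
      Complex.I * ((∫ p, p.2 * f p.1 ∂(pointMeasure ω) : ℝ) : ℂ)) ∂(sampleLaw r ν) =
      Complex.exp (∫ p, ((levyRatio l θ p : ℂ) *
        (Complex.exp (Complex.I * ((p.2 * f p.1 : ℝ) : ℂ)) - 1)) ∂(levyMeasure σ l) +
        ((∫ p, (levyRatio l θ p - 1) ∂(levyMeasure σ l) : ℝ) : ℂ)) := by
  obtain ⟨C, hC⟩ := f.hasCompactSupport.exists_bound_of_continuous f.continuous
  have hz : ∀ x ∉ tsupport f, f x = 0 := fun x hx => image_eq_zero_of_notMem_tsupport hx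
  have hfm : Measurable f := f.continuous.measurable
  have hρm := measurable_levyRatio hl θ
  set e : X × ℝ → ℂ := fun p => Complex.exp (Complex.I * ((p.2 * f p.1 : ℝ) : ℂ)) with he
  have hem : Measurable e := by fun_prop
  have he1 : ∀ p, ‖e p‖ = 1 := fun p => by
    rw [he]; simp only; rw [mul_comm, Complex.norm_exp_ofReal_mul_I]
  have hei : Integrable (fun p => e p - 1) (levyMeasure σ l) := by
    rw [← hrν]
    exact hm.integrable_exp hfm hC f.hasCompactSupport hz
  have hρi : Integrable (fun p => ((levyRatio l θ p - 1 : ℝ) : ℂ)) (levyMeasure σ l) := hint.ofReal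
  have hprod : Integrable (fun p => ((levyRatio l θ p - 1 : ℝ) : ℂ) * e p) (levyMeasure σ l) :=
    hρi.mul_bdd (c := 1) hem.aestronglyMeasurable (Eventually.of_forall fun p => (he1 p).le)
  -- Neither `ρ` nor `e` need be integrable separately; use `ρ (e - 1) = (ρ - 1) e - (ρ - 1) + (e -
  -- 1)`.
  have hmain : Integrable (fun p => (levyRatio l θ p : ℂ) * (e p - 1)) (levyMeasure σ l) := by
    refine ((hprod.sub hρi).add hei).congr (Eventually.of_forall fun p => ?_)
    simp only [Pi.add_apply, Pi.sub_apply]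
    push_cast
    ring
  set h : X × ℝ → ℂ := fun p => (Real.log (levyRatio l θ p) : ℂ) +
    Complex.I * ((p.2 * f p.1 : ℝ) : ℂ) with hh
  have hlm : Measurable fun p => Real.log (levyRatio l θ p) := Real.measurable_log.comp hρm
  have hhm : Measurable h := by fun_prop
  have hexp : (fun p => Complex.exp (h p) - 1) =ᵐ[levyMeasure σ l]
      fun p => (levyRatio l θ p : ℂ) * (e p - 1) + ((levyRatio l θ p - 1 : ℝ) : ℂ) := by
    filter_upwards [ae_levyMeasure hl hl_pos] with p hp
    simp only [hh, he]
    rw [Complex.exp_add, ← Complex.ofReal_exp, Real.exp_log (levyRatio_pos θ hp)]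
    push_cast
    ring
  have hlogN : ∀ᵐ ω ∂(sampleLaw r ν),
      Integrable (fun p => Real.log (levyRatio l θ p)) (pointMeasure ω) := by
    refine ae_integrable_pointMeasure r ν hlm ?_
    rw [hrν]
    exact lintegral_min_log_levyRatio_lt_top hl hl_pos θ hint
  have hfN : ∀ᵐ ω ∂(sampleLaw r ν), Integrable (fun p => p.2 * f p.1) (pointMeasure ω) :=
    ae_integrable_pointMeasure r ν (by fun_prop)
      (hm.lintegral_min_lt_top hC f.hasCompactSupport hz)
  have hhN : ∀ᵐ ω ∂(sampleLaw r ν), Integrable h (pointMeasure ω) ∧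
      ∫ p, h p ∂(pointMeasure ω) =
        ((∫ p, Real.log (levyRatio l θ p) ∂(pointMeasure ω) : ℝ) : ℂ) +
      Complex.I * ((∫ p, p.2 * f p.1 ∂(pointMeasure ω) : ℝ) : ℂ) := by
    filter_upwards [hlogN, hfN] with ω h1 h2
    have h1' : Integrable (fun p => (Real.log (levyRatio l θ p) : ℂ)) (pointMeasure ω) := h1.ofReal
    have h2' : Integrable (fun p => Complex.I * ((p.2 * f p.1 : ℝ) : ℂ)) (pointMeasure ω) :=
      h2.ofReal.const_mul _
    refine ⟨h1'.add h2', ?_⟩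
    rw [hh, integral_add h1' h2', integral_const_mul, integral_complex_ofReal,
      integral_complex_ofReal]
  obtain ⟨c1, c2⟩ := integral_exp_integral_pointMeasure r ν hhm
    (by rw [hrν]; exact (hmain.add hρi).congr hexp.symm) (hhN.mono fun ω hω => hω.1)
  have hcongr : (fun ω => Complex.exp (∫ p, h p ∂(pointMeasure ω))) =ᵐ[sampleLaw r ν] fun ω =>
      Complex.exp (((∫ p, Real.log (levyRatio l θ p) ∂(pointMeasure ω) : ℝ) : ℂ) +
      Complex.I * ((∫ p, p.2 * f p.1 ∂(pointMeasure ω) : ℝ) : ℂ)) := by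
    filter_upwards [hhN] with ω hω
    rw [hω.2]
  refine ⟨c1.congr hcongr, ?_⟩
  rw [← integral_congr_ae hcongr, c2, hrν, integral_congr_ae hexp, integral_add hmain hρi,
    integral_complex_ofReal]

/-- The function `f ↦ θ f` on test functions. -/
def Current.mulTest (θ : Current X) (f : C_c(X, ℝ)) : C_c(X, ℝ) :=
  ⟨⟨fun x => θ x * f x, θ.continuous'.mul f.continuous⟩, f.hasCompactSupport.mul_left⟩

theorem integral_act (θ : Current X) (f : C_c(X, ℝ)) (η : RadonMeasure X) :
    ∫ x, f x ∂(θ.act η).1 = ∫ x, θ.mulTest f x ∂η.1 := by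
  simp only [Current.act]
  rw [integral_withDensity_eq_integral_toReal_smul
    (θ.continuous'.measurable.ennreal_ofReal)
    (Eventually.of_forall fun _ => ENNReal.ofReal_lt_top)]
  refine integral_congr_ae (Eventually.of_forall fun x => ?_)
  simp [Current.mulTest, ENNReal.toReal_ofReal (θ.pos' x).le]

/-- The law of `sampleRadon` is transformed by `θ` into a measure with density
`currentDensity σ l θ`. -/
theorem map_act_sampleRadon (hl : Measurable (Function.uncurry l))
    (hl_pos : ∀ x, (∀ s : ℝ, 0 < s → 0 < l x s) ∨ (∀ s : ℝ, 0 < s → l x s = 0))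
    (hm : IsLevy (intensity r ν)) (hrν : intensity r ν = levyMeasure σ l)
    (h0 : ∀ x, intensity r ν (Prod.fst ⁻¹' {x}) = 0) (θ : Current X)
    (hfin : ∫⁻ x in posSet l, ∫⁻ s in Ioi (0 : ℝ),
      ENNReal.ofReal (|l x ((θ x)⁻¹ * s) - l x s| / s) ∂volume ∂σ < ⊤) :
    ((sampleLaw r ν).map sampleRadon).map θ.act =
      ((sampleLaw r ν).map sampleRadon).withDensity
        fun η => ENNReal.ofReal (currentDensity σ l θ η) := by
  have hint := integrable_levyRatio_sub_one hl hl_pos θ hfin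
  have hY := measurableSet_posSet hl hl_pos
  have hDm := measurable_currentDensity σ hl hY θ
  have hact : Measurable θ.act := θ.continuous_act.measurable
  have hL := hasLevyMeasure_sampleRadon r ν hm
  set μ := (sampleLaw r ν).map (sampleRadon : Sample (X × ℝ) → RadonMeasure X) with hμ
  have hμP : IsProbabilityMeasure μ := hL.isProbabilityMeasure
  set c : ℝ := ∫ x in posSet l, ∫ s in Ioi (0 : ℝ), compensator l θ x s ∂volume ∂σ with hc_def
  -- The compensator is exactly the term that cancels `∫ (ρ - 1) dm` in the weighted Fourier
  -- transform.
  have hc : c = - ∫ p, (levyRatio l θ p - 1) ∂(levyMeasure σ l) := by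
    rw [hc_def, integral_compensator hl hl_pos θ (integrable_compensator hl θ hfin),
      ← integral_neg]
    simp
  have hD : ∀ᵐ ω ∂(sampleLaw r ν), currentDensity σ l θ (sampleRadon ω) =
      Real.exp ((∫ p, Real.log (levyRatio l θ p) ∂(pointMeasure ω)) + c) := by
    filter_upwards [ae_integral_logRatio r ν hl hl_pos hm hrν h0 θ hint] with ω hω
    rw [currentDensity, hω.2]
  have hF : ∀ f : C_c(X, ℝ), (fun ω => (currentDensity σ l θ (sampleRadon ω) : ℂ) *
      Complex.exp (Complex.I * ((∫ x, f x ∂(sampleRadon ω).1 : ℝ) : ℂ))) =ᵐ[sampleLaw r ν]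
      fun ω => Complex.exp c *
        Complex.exp (((∫ p, Real.log (levyRatio l θ p) ∂(pointMeasure ω) : ℝ) : ℂ) +
      Complex.I * ((∫ p, p.2 * f p.1 ∂(pointMeasure ω) : ℝ) : ℂ)) := fun f => by
    filter_upwards [hD, ae_isFiniteMeasureOnCompacts r ν hm, ae_ae_pos r ν hm] with ω h1 h2 h3
    have hcoe : (sampleRadon ω).1 = rawMeasure ω := sampleMeasure_of_finite h2
    have hfs : StronglyMeasurable fun x => f x := f.continuous.measurable.stronglyMeasurable
    rw [h1, hcoe, integral_rawMeasure ω h3 hfs,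
      Complex.ofReal_exp, ← Complex.exp_add, ← Complex.exp_add]
    simp only [smul_eq_mul]
    push_cast
    ring_nf
  have hDpos : ∀ η, 0 < currentDensity σ l θ η := fun η => Real.exp_pos _
  have hDint : Integrable (currentDensity σ l θ) μ := by
    rw [hμ, integrable_map_measure hDm.aestronglyMeasurable measurable_sampleRadon.aemeasurable]
    -- The test function `0` leaves only the density itself, whose integrability makes the weighted
    -- measure finite, as uniqueness of the Fourier transform requires.
    have h1 := ((integral_exp_log_levyRatio r ν hl hl_pos hm hrν θ hint 0).1.const_mul
      (Complex.exp c)).congr (hF 0).symm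
    refine h1.norm.congr (Eventually.of_forall fun ω => ?_)
    simp [abs_of_pos (hDpos _)]
  have hfinite : IsFiniteMeasure (μ.withDensity fun η => ENNReal.ofReal (currentDensity σ l θ η)) :=
    isFiniteMeasure_withDensity_ofReal hDint.2
  have hfinite' : IsProbabilityMeasure (μ.map θ.act) :=
    Measure.isProbabilityMeasure_map hact.aemeasurable
  have hem : ∀ f : C_c(X, ℝ), Measurable fun η : RadonMeasure X =>
      Complex.exp (Complex.I * ((∫ x, f x ∂η.1 : ℝ) : ℂ)) := fun f => by
    have := measurable_integral_radon f
    fun_prop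
  refine ext_of_fourier fun f => ?_
  rw [integral_map hact.aemeasurable (hem f).aestronglyMeasurable]
  simp_rw [integral_act]
  rw [hL.fourier, integral_withDensity_eq_integral_toReal_smul hDm.ennreal_ofReal
    (Eventually.of_forall fun _ => ENNReal.ofReal_lt_top)]
  have e1 : ∀ η : RadonMeasure X, (ENNReal.ofReal (currentDensity σ l θ η)).toReal •
      Complex.exp (Complex.I * ((∫ x, f x ∂η.1 : ℝ) : ℂ)) = (currentDensity σ l θ η : ℂ) *
      Complex.exp (Complex.I * ((∫ x, f x ∂η.1 : ℝ) : ℂ)) := fun η => by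
    rw [ENNReal.toReal_ofReal (hDpos η).le, Complex.real_smul]
  simp_rw [e1]
  have hm1 : Measurable fun η : RadonMeasure X => (currentDensity σ l θ η : ℂ) *
      Complex.exp (Complex.I * ((∫ x, f x ∂η.1 : ℝ) : ℂ)) :=
    (Complex.measurable_ofReal.comp hDm).mul (hem f)
  rw [hμ, integral_map measurable_sampleRadon.aemeasurable hm1.aestronglyMeasurable,
    integral_congr_ae (hF f), integral_const_mul,
    (integral_exp_log_levyRatio r ν hl hl_pos hm hrν θ hint f).2, ← Complex.exp_add, hrν]
  congr 1
  have hG : Measurable fun p : X × ℝ =>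
      Complex.exp (Complex.I * ((p.2 * f p.1 : ℝ) : ℂ)) - 1 := by
    have := f.continuous.measurable
    fun_prop
  -- After cancellation the weighted exponent is `∫ ρ (e^{isf} - 1) dm`; this identifies it with `∫
  -- (e^{iθsf} - 1) dm`, the exponent of the image law.
  have e2 := integral_comp_scale_levyMeasure (σ := σ) hl hl_pos θ hG
  simp only at e2
  rw [← e2, hc]
  push_cast
  rw [add_comm, add_assoc, add_neg_cancel, add_zero]
  refine integral_congr_ae (Eventually.of_forall fun p => ?_)
  have h4 : p.2 * θ.mulTest f p.1 = θ p.1 * p.2 * f p.1 := by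
    change p.2 * (θ p.1 * f p.1) = θ p.1 * p.2 * f p.1
    ring
  have h5 := congrArg (fun t : ℝ => (t : ℂ)) h4
  push_cast at h5
  simp only [h5]

end Density

end CRM

end

noncomputable section

namespace CRM

open Filter PoissonRandom
open scoped CompactlySupported ENNReal NNReal

-- The empty space, and transfer from the Poisson model to every `μ_m`.

section Empty

variable {X : Type*} [TopologicalSpace X] [MeasurableSpace X]

instance [IsEmpty X] : Subsingleton (RadonMeasure X) :=
  ⟨fun _ _ => Subtype.ext (Subsingleton.elim _ _)⟩

/-- The batches are drawn from probability measures, which do not exist on an empty space; this case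
is treated by hand. -/
theorem hasLevyMeasure_dirac_of_isEmpty [IsEmpty X] (η₀ : RadonMeasure X) (m : Measure (X × ℝ)) :
    HasLevyMeasure (Measure.dirac η₀) m where
  isProbabilityMeasure := inferInstance
  isCompletelyRandom n A _ _ := by
    rw [iIndepFun_iff_measure_inter_preimage_eq_mul]
    intro S sets hsets
    have hm : ∀ T : Set (RadonMeasure X), MeasurableSet T := fun T =>
      Subsingleton.measurableSet
    simp only [Measure.dirac_apply' _ (hm _)]
    classical
    by_cases h : ∀ i ∈ S, η₀ ∈ (fun η : RadonMeasure X => η.1 (A i)) ⁻¹' sets i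
    · rw [indicator_of_mem (mem_iInter₂.2 h)]
      exact (Finset.prod_eq_one fun i hi => by rw [indicator_of_mem (h i hi), Pi.one_apply]).symm
    · rw [indicator_of_notMem fun h' => h (mem_iInter₂.1 h')]
      push Not at h
      obtain ⟨i, hi, hi'⟩ := h
      exact (Finset.prod_eq_zero hi (indicator_of_notMem hi' _)).symm
  ae_mem_discreteRadon := Eventually.of_forall fun η =>
    ⟨∅, countable_empty, fun _ => 1, fun _ => one_pos, Subsingleton.elim _ _⟩
  fourier f := by
    simp [Measure.eq_zero_of_isEmpty]

end Empty

variable {X : Type*} [TopologicalSpace X] [PolishSpace X] [LocallyCompactSpace X]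
  [MeasurableSpace X] [BorelSpace X] {σ : Measure X} [IsFiniteMeasureOnCompacts σ] {l : X → ℝ → ℝ}

theorem HasLevyMeasure.unique {μ μ' : Measure (RadonMeasure X)} {m : Measure (X × ℝ)}
    (h : HasLevyMeasure μ m) (h' : HasLevyMeasure μ' m) : μ = μ' := by
  have := h.isProbabilityMeasure
  have := h'.isProbabilityMeasure
  exact ext_of_fourier fun f => (h.fourier f).trans (h'.fourier f).symm

theorem measurableSet_integrableOn_logRatio (hl : Measurable (Function.uncurry l))
    (hY : MeasurableSet (posSet l)) (θ : Current X) :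
    MeasurableSet {η : RadonMeasure X | IntegrableOn (logRatio l θ η) (posSet l) η.1} := by
  have hL := measurable_logRatio hl θ
  have h : Measurable fun η : RadonMeasure X => ∫⁻ x in posSet l, ‖logRatio l θ η x‖ₑ ∂η.1 := by
    have := Measurable.lintegral_kernel_prod_right (κ := (radonKernel X).restrict hY)
      (f := fun η x => ‖logRatio l θ η x‖ₑ) hL.enorm
    simp_rw [Kernel.restrict_apply] at this
    exact this
  have e : {η : RadonMeasure X | IntegrableOn (logRatio l θ η) (posSet l) η.1} =
      {η | ∫⁻ x in posSet l, ‖logRatio l θ η x‖ₑ ∂η.1 < ⊤} := by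
    ext η
    have hη : Measurable (logRatio l θ η) := hL.comp measurable_prodMk_left
    exact ⟨fun h => h.2, fun h => ⟨hη.aestronglyMeasurable, h⟩⟩
  rw [e]
  exact measurableSet_lt h measurable_const

theorem exists_sampleRadon_hasLevyMeasure [Nonempty X] (hl : Measurable (Function.uncurry l))
    (hl_pos : ∀ x, (∀ s : ℝ, 0 < s → 0 < l x s) ∨ (∀ s : ℝ, 0 < s → l x s = 0))
    (hl_int : ∀ A ∈ boundedBorel (posSet l),
      ∫⁻ x in A, ∫⁻ s in Ioi (0 : ℝ), ENNReal.ofReal (l x s * min s⁻¹ 1) ∂volume ∂σ < ⊤) :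
    ∃ (r : ℕ → ℝ≥0) (ν : ℕ → Measure (X × ℝ)), (∀ k, IsProbabilityMeasure (ν k)) ∧
      intensity r ν = levyMeasure σ l ∧ IsLevy (intensity r ν) ∧
      HasLevyMeasure ((sampleLaw r ν).map sampleRadon) (levyMeasure σ l) := by
  have : SFinite (levyMeasure σ l) := by unfold levyMeasure; infer_instance
  obtain ⟨r, ν, hν, hrν⟩ := exists_intensity_eq (levyMeasure σ l)
  have hm : IsLevy (intensity r ν) := hrν ▸ isLevy_levyMeasure hl hl_pos hl_int
  exact ⟨r, ν, hν, hrν, hm, hrν ▸ hasLevyMeasure_sampleRadon r ν hm⟩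

theorem exists_hasLevyMeasure (hl : Measurable (Function.uncurry l))
    (hl_pos : ∀ x, (∀ s : ℝ, 0 < s → 0 < l x s) ∨ (∀ s : ℝ, 0 < s → l x s = 0))
    (hl_int : ∀ A ∈ boundedBorel (posSet l),
      ∫⁻ x in A, ∫⁻ s in Ioi (0 : ℝ), ENNReal.ofReal (l x s * min s⁻¹ 1) ∂volume ∂σ < ⊤) :
    ∃ μ : Measure (RadonMeasure X), HasLevyMeasure μ (levyMeasure σ l) := by
  rcases isEmpty_or_nonempty X with h | h
  · exact ⟨_, hasLevyMeasure_dirac_of_isEmpty ⟨0, inferInstance⟩ _⟩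
  · obtain ⟨r, ν, _, _, _, h⟩ := exists_sampleRadon_hasLevyMeasure hl hl_pos hl_int
    exact ⟨_, h⟩

/-- By uniqueness of the law, `μ` may be replaced by the law of `sampleRadon`. Integrability of
`logRatio` transfers because it defines a measurable set of Radon measures. -/
theorem HasLevyMeasure.map_act (hσ : ∀ x, σ {x} = 0) (hl : Measurable (Function.uncurry l))
    (hl_pos : ∀ x, (∀ s : ℝ, 0 < s → 0 < l x s) ∨ (∀ s : ℝ, 0 < s → l x s = 0))
    (hl_int : ∀ A ∈ boundedBorel (posSet l),
      ∫⁻ x in A, ∫⁻ s in Ioi (0 : ℝ), ENNReal.ofReal (l x s * min s⁻¹ 1) ∂volume ∂σ < ⊤)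
    (θ : Current X)
    (hfin : ∫⁻ x in posSet l, ∫⁻ s in Ioi (0 : ℝ),
      ENNReal.ofReal (|l x ((θ x)⁻¹ * s) - l x s| / s) ∂volume ∂σ < ⊤)
    {μ : Measure (RadonMeasure X)} (hμ : HasLevyMeasure μ (levyMeasure σ l)) :
    (∀ᵐ η ∂μ, IntegrableOn (logRatio l θ η) (posSet l) η.1) ∧
      μ.map θ.act = μ.withDensity fun η => ENNReal.ofReal (currentDensity σ l θ η) := by
  rcases isEmpty_or_nonempty X with h | h
  · have hact : θ.act = id := funext fun η => Subsingleton.elim _ _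
    refine ⟨Eventually.of_forall fun η => ?_, ?_⟩
    · rw [Measure.eq_zero_of_isEmpty η.1, IntegrableOn, Measure.restrict_zero]
      exact integrable_zero_measure
    · have hD : ∀ η, currentDensity σ l θ η = 1 := fun η => by
        simp [currentDensity, Measure.eq_zero_of_isEmpty]
      simp_rw [hD, hact, Measure.map_id, ENNReal.ofReal_one]
      exact withDensity_one.symm
  · obtain ⟨r, ν, hν, hrν, hm, hL⟩ := exists_sampleRadon_hasLevyMeasure hl hl_pos hl_int
    have h0 : ∀ x, intensity r ν (Prod.fst ⁻¹' {x}) = 0 := fun x => hrν ▸ levyMeasure_fiber hσ x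
    have hY := measurableSet_posSet hl hl_pos
    rw [hμ.unique hL]
    refine ⟨?_, map_act_sampleRadon r ν hl hl_pos hm hrν h0 θ hfin⟩
    rw [ae_map_iff measurable_sampleRadon.aemeasurable
      (measurableSet_integrableOn_logRatio hl hY θ)]
    exact (ae_integral_logRatio r ν hl hl_pos hm hrν h0 θ
      (integrable_levyRatio_sub_one hl hl_pos θ hfin)).mono fun ω h => h.1

end CRM

end

theorem corollary3p3 {X : Type*} [TopologicalSpace X] [PolishSpace X] [LocallyCompactSpace X]
    [MeasurableSpace X] [BorelSpace X]
    (σ : Measure X) [IsFiniteMeasureOnCompacts σ] (hσ : ∀ x, σ {x} = 0)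
    (l : X → ℝ → ℝ) (hl_meas : Measurable (Function.uncurry l))
    (hl_pos : ∀ x, (∀ s : ℝ, 0 < s → 0 < l x s) ∨ (∀ s : ℝ, 0 < s → l x s = 0))
    (hl_int : ∀ A ∈ CRM.boundedBorel (CRM.posSet l),
      ∫⁻ x in A, ∫⁻ s in Ioi (0 : ℝ), ENNReal.ofReal (l x s * min s⁻¹ 1) ∂volume ∂σ < ⊤)
    (ε : ℝ) (hε : 0 < ε) (l₁ l₂ : X → ℝ → ℝ)
    (hl₁_meas : Measurable (Function.uncurry l₁)) (hl₂_meas : Measurable (Function.uncurry l₂))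
    (hl_add : ∀ x ∈ CRM.posSet l, ∀ s ∈ Ioo (0 : ℝ) ε, l x s = l₁ x s + l₂ x s)
    (hl₁_diff : ∀ x ∈ CRM.posSet l, DifferentiableOn ℝ (l₁ x) (Ioo (0 : ℝ) ε))
    (hl₁_int : ∀ n : ℕ, 1 ≤ n → ∀ A ∈ CRM.boundedBorel (CRM.posSet l),
      ∫⁻ x in A, ∫⁻ s in Ioo (0 : ℝ) (ε / n),
        ⨆ u ∈ Icc (s / n) (s * n), ENNReal.ofReal |deriv (l₁ x) u| ∂volume ∂σ < ⊤)
    (hl₂_int : ∀ A ∈ CRM.boundedBorel (CRM.posSet l),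
      ∫⁻ x in A, ∫⁻ s in Ioo (0 : ℝ) ε, ENNReal.ofReal (|l₂ x s| / s) ∂volume ∂σ < ⊤) :
    CRM.ScalingCondition σ l ∧
    (∃ μ : Measure (CRM.RadonMeasure X), CRM.HasLevyMeasure μ (CRM.levyMeasure σ l)) ∧
    ∀ μ : Measure (CRM.RadonMeasure X), CRM.HasLevyMeasure μ (CRM.levyMeasure σ l) →
      ∀ θ : CRM.Current X,
        (∀ η ∈ CRM.discreteRadon X, θ.act η ∈ CRM.discreteRadon X) ∧
        μ.map θ.act ≪ μ ∧ μ ≪ μ.map θ.act ∧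
        (∀ᵐ η ∂μ, IntegrableOn (CRM.logRatio l θ η) (CRM.posSet l) η.1) ∧
        Integrable (fun p : X × ℝ => CRM.compensator l θ p.1 p.2)
          ((σ.restrict (CRM.posSet l)).prod (volume.restrict (Ioi (0 : ℝ)))) ∧
        (μ.map θ.act).rnDeriv μ =ᵐ[μ]
          fun η => ENNReal.ofReal (CRM.currentDensity σ l θ η) := by
  have hsc := CRM.scalingCondition hε hl₂_meas hl_add hl₁_diff hl₁_int hl₂_int
  refine ⟨hsc, CRM.exists_hasLevyMeasure hl_meas hl_pos hl_int, fun μ hμ θ => ?_⟩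
  have hfin := CRM.lintegral_compensator_lt_top hl_meas hl_pos hl_int hsc θ
  obtain ⟨hlog, hmap⟩ := hμ.map_act hσ hl_meas hl_pos hl_int θ hfin
  have := hμ.isProbabilityMeasure
  have hD : Measurable fun η => ENNReal.ofReal (CRM.currentDensity σ l θ η) :=
    (CRM.measurable_currentDensity σ hl_meas (CRM.measurableSet_posSet hl_meas hl_pos)
      θ).ennreal_ofReal
  refine ⟨fun η hη => CRM.act_mem_discreteRadon θ hη, ?_, ?_, hlog,
    CRM.integrable_compensator hl_meas θ hfin, ?_⟩
  · rw [hmap]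
    exact withDensity_absolutelyContinuous _ _
  · rw [hmap]
    -- The density is an exponential, hence nowhere zero, which gives absolute continuity in the
    -- other direction.
    exact withDensity_absolutelyContinuous' hD.aemeasurable
      (Filter.Eventually.of_forall fun η => (ENNReal.ofReal_pos.2 (Real.exp_pos _)).ne')
  · rw [hmap]
    exact Measure.rnDeriv_withDensity μ hD
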